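/- Let $n\ge 0$ and let $W=W(B_n)$ be the group of permutations $w$ of $\{-n,\dots,n\}$ with $w(-i)=-w(i)$ for all $i$. For distinct positive integers $i_1,\dots,i_k\le n$ write $(i_1,\dots,i_k)$ for the positive cycle, i.e. the permutation $(i_1,\dots,i_k)(-i_1,\dots,-i_k)$, and $(i_1,\dots,i_k)^-$ for the negative cycle, i.e. the permutation $(i_1,\dots,i_k,-i_1,\dots,-i_k)$. Let $S$ be the set of Coxeter generators $t_1=(1)^-$ (if $n\ge1$) and $s_i=(i,i+1)$, $1\le i\le n-1$. For $w\in W$ let $J(w)\subseteq S$ be the set of generators occurring in a reduced (i.e. shortest possible) expression of $w$ as a product of elements of $S$ (this set does not depend on the reduced expression), and for $J\subseteq S$ let $W_J=\langle J\rangle$. Let $\lambda=(\lambda^+,\lambda^-)$ be a double partition of $n$, i.e. a pair of partitions with $|\lambda^+|+|\lambda^-|=n$. Let $w_\lambda\in W$ be the standard representative of the conjugacy class of signed permutations that have a positive cycle of length $l$ for each part $l$ of $\lambda^+$ and a negative cycle of length $l$ for each part $l$ of $\lambda^-$: the negative cycles of $w_\lambda$ are on the points $1,\dots,|\lambda^-|$,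 the positive cycles are on the points $|\lambda^-|+1,\dots,n$, each cycle consists of consecutive numbers in increasing order, and within each of the two kinds the cycles are arranged by weakly increasing length. (For example, $\lambda=(112,23)$ gives $w_\lambda=(1,2)^-(3,4,5)^-(6)(7)(8,9)$.) Let $J=J(w_\lambda)$. For $1\le m\le n$ let $a_m$ be the number of parts of $\lambda^+$ equal to $m$ and let $$o_m=|\lambda^-|+a_1+2a_2+\dots+(m-1)a_{m-1}.$$ Put $t(o,m)=(o+1)^-(o+2)^-\cdots(o+m)^-$ and $s(o,m)=(o+1,o+2,\dots,o+2m)^m$; the latter swaps the adjacent blocks $\{o+1,\dots,o+m\}$ and $\{o+m+1,\dots,o+2m\}$. Then $$N_\lambda=\big\langle\, t(o_m,m),\ s(o_m+km,m)\ :\ 1\le m\le n,\ a_m>0,\ 0\le k\le a_m-2 \,\big\rangle$$ is a complement of $C_{W_J}(w_\lambda)$ in $C_W(w_\lambda)$; that is, both are subgroups of $C_W(w_\lambda)$, $N_\lambda\cap C_{W_J}(w_\lambda)=1$ and $C_{W_J}(w_\lambda)\,N_\lambda=C_W(w_\lambda)$. (For each $m$ with $a_m=1$, only $t(o_m,m)$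 occurs among the generators.) -/

import Mathlib

/-- The Coxeter group `W(B_n)`, realized as the group of signed permutations of
`{-n, …, n}`, i.e. those `w` with `w (-i) = -w i`. Such a permutation is extended to `ℤ` by the
identity outside `{-n, …, n}`, so that `W(B_n)` is a subgroup of the permutations of `ℤ`. -/
def weylB (n : ℕ) : Subgroup (Equiv.Perm ℤ) where
  carrier := {w | (∀ i, w (-i) = -w i) ∧ ∀ i : ℤ, (n : ℤ) < |i| → w i = i}
  one_mem' := by simp
  mul_mem' := by
    rintro a b ⟨ha, ha'⟩ ⟨hb, hb'⟩
    refine ⟨fun i => ?_, fun i hi => ?_⟩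
    · simp [ha, hb]
    · simp [hb' i hi, ha' i hi]
  inv_mem' := by
    rintro a ⟨ha, ha'⟩
    refine ⟨fun i => ?_, fun i hi => ?_⟩
    · rw [Equiv.Perm.inv_eq_iff_eq, ha]; simp
    · rw [Equiv.Perm.inv_eq_iff_eq, ha' i hi]

namespace SignedPerm

/-- The positive cycle `(i₁, …, i_k)`, an abbreviation of `(i₁, …, i_k)(-i₁, …, -i_k)`. -/
def posCycle (l : List ℤ) : Equiv.Perm ℤ :=
  l.formPerm * (l.map (fun i => -i)).formPerm

/-- The negative cycle `(i₁, …, i_k)⁻`, an abbreviation of `(i₁, …, i_k, -i₁, …, -i_k)`. -/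
def negCycle (l : List ℤ) : Equiv.Perm ℤ :=
  (l ++ l.map (fun i => -i)).formPerm

/-- The `m` successive points `o + 1, …, o + m`. -/
def block (o m : ℕ) : List ℤ :=
  (List.range m).map (fun i => (o : ℤ) + (i : ℤ) + 1)

/-- `t(o, m) = (o+1)⁻ (o+2)⁻ ⋯ (o+m)⁻`. -/
def blockSign (o m : ℕ) : Equiv.Perm ℤ :=
  ((block o m).map (fun i => negCycle [i])).prod

/-- `s(o, m) = (o+1, o+2, …, o+2m)^m`, which swaps the adjacent blocks
`o+1, …, o+m` and `o+m+1, …, o+2m`. -/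
def blockSwap (o m : ℕ) : Equiv.Perm ℤ :=
  posCycle (block o (2 * m)) ^ m

/-- The Coxeter generators of `W(B_n)`: `t₁ = (1)⁻` (if `n ≥ 1`) and `s_i = (i, i+1)` for
`1 ≤ i ≤ n - 1`. -/
def simpleReflections (n : ℕ) : Set (Equiv.Perm ℤ) :=
  {σ | 1 ≤ n ∧ σ = negCycle [1]} ∪
    {σ | ∃ i : ℕ, 1 ≤ i ∧ i + 1 ≤ n ∧ σ = posCycle [(i : ℤ), (i : ℤ) + 1]}

/-- `l` is a reduced expression of `w` in the Coxeter generators of `W(B_n)`. -/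
def IsReducedExpr (n : ℕ) (w : Equiv.Perm ℤ) (l : List (Equiv.Perm ℤ)) : Prop :=
  (∀ s ∈ l, s ∈ simpleReflections n) ∧ l.prod = w ∧
    ∀ l' : List (Equiv.Perm ℤ), (∀ s ∈ l', s ∈ simpleReflections n) → l'.prod = w →
      l.length ≤ l'.length

/-- `J(w)`: the set of generators that occur in a reduced expression of `w` (by Matsumoto's
theorem, all reduced expressions of `w` have the same set of letters). -/
def supportJ (n : ℕ) (w : Equiv.Perm ℤ) : Set (Equiv.Perm ℤ) :=
  {s | ∃ l, IsReducedExpr n w l ∧ s ∈ l}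

/-- The standard parabolic subgroup `W_J` for `J ⊆ S`. -/
def parabolic (J : Set (Equiv.Perm ℤ)) : Subgroup (Equiv.Perm ℤ) :=
  Subgroup.closure J

/-- The centralizer `C_H(w)` of `w` in the subgroup `H`. -/
def centralizerIn {G : Type*} [Group G] (H : Subgroup G) (w : G) : Subgroup G :=
  H ⊓ Subgroup.centralizer {w}

/-- `K` is a complement of `H` in `C`: both are subgroups of `C`, `H ∩ K = 1` and `H K = C`. -/
def IsComplementIn {G : Type*} [Group G] (H K C : Subgroup G) : Prop :=
  H ≤ C ∧ K ≤ C ∧ Subgroup.IsComplement' (H.subgroupOf C) (K.subgroupOf C)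

/-- The product of the cycles `c` on successive blocks of points, with block lengths given by the
list, the first block starting after the offset. -/
def cyclesProd (c : List ℤ → Equiv.Perm ℤ) : ℕ → List ℕ → Equiv.Perm ℤ
  | _, [] => 1
  | o, m :: l => c (block o m) * cyclesProd c (o + m) l

end SignedPerm

/-- A double partition `(λ⁺, λ⁻)` of `n`: two partitions, given by their multisets of
parts, with `|λ⁺| + |λ⁻| = n`. -/
structure DoublePartition (n : ℕ) where
  pos : Multiset ℕ
  neg : Multiset ℕ
  pos_parts : ∀ m ∈ pos, 0 < m
  neg_parts : ∀ m ∈ neg, 0 < m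
  sum_eq : pos.sum + neg.sum = n

namespace DoublePartition

open SignedPerm

variable {n : ℕ} (lam : DoublePartition n)

/-- The standard representative `w_λ`: the negative cycles are on `1, …, |λ⁻|` and the
positive cycles on `|λ⁻| + 1, …, n`; each cycle consists of consecutive numbers in increasing
order, and the cycle lengths increase weakly within each of the two kinds. -/
def rep : Equiv.Perm ℤ :=
  cyclesProd negCycle 0 (lam.neg.sort (· ≤ ·)) *
    cyclesProd posCycle lam.neg.sum (lam.pos.sort (· ≤ ·))

/-- `a_m`, the number of parts of `λ⁺` equal to `m`. -/
def mult (m : ℕ) : ℕ := lam.pos.count m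

/-- The offset `o_m = |λ⁻| + a_1 + 2 a_2 + ⋯ + (m-1) a_{m-1}`. -/
def offset (m : ℕ) : ℕ := lam.neg.sum + ∑ i ∈ Finset.Ico 1 m, i * lam.mult i

/-- `N_λ`, generated by the `t(o_m, m)` and the `s(o_m + k m, m)`, `k = 0, …, a_m - 2`, for those
`m ∈ {1, …, n}` with `a_m > 0`. -/
def complementN : Subgroup (Equiv.Perm ℤ) :=
  Subgroup.closure {σ | ∃ m : ℕ, 1 ≤ m ∧ m ≤ n ∧ 0 < lam.mult m ∧
    (σ = blockSign (lam.offset m) m ∨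
      ∃ k : ℕ, k + 2 ≤ lam.mult m ∧ σ = blockSwap (lam.offset m + k * m) m)}

end DoublePartition

/-! The proof is a sorting argument. For a signed permutation `v`, the pairing of `v` with the
identity, the sum of `x * v x`, is bounded, and it strictly increases when `v` is multiplied on the
right by an involution `s` with `v (s x) < v x` whenever `x < s x` (`IsDescent`). Hence, if every
element of a group outside a subset `K` has a descent in `T`, products of elements of `T` move
everything into `K` (`exists_mul_mem_of_descents`).

With `K = {1}`, sorting shows that the Coxeter generators generate and describes `W_J` by cuts: `v`
lies in `W_J`, for `J = J(w)`, exactly when it preserves every set `{x > i}` that `w` preserves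
(`mem_parabolic_supportJ`). This needs that such a cut `i` keeps the `i`-th generator out of all
reduced expressions, which follows from Deodhar's lemma.

For `w_λ` the cuts include both ends of every positive cycle, so `W_J` keeps each positive cycle in
place with its sign. Elements of `N_λ` permute the positive cycles of equal length up to sign,
without rotation, and fix the negative cycles (`IsBlockPerm`). Only the identity does both.

For the product, sorting is applied to the centralizer of `w_λ` with `K = W_J` and the generators of
`N_λ`. A centralizing element carries positive cycles to positive cycles of the same length, up to
sign and rotation. If no generator is a descent, the signs are positive and the cycles of each
length keep their order, hence their places, so the element lies in `W_J`. -/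

namespace SignedPerm

/-! ### Signed permutations and sorting by descents -/

theorem weylB_neg {n : ℕ} {v : Equiv.Perm ℤ} (hv : v ∈ weylB n) (x : ℤ) : v (-x) = -v x :=
  hv.1 x

theorem weylB_zero {n : ℕ} {v : Equiv.Perm ℤ} (hv : v ∈ weylB n) : v 0 = 0 := by
  have := hv.1 0
  simp only [neg_zero] at this
  omega

theorem weylB_abs_le {n : ℕ} {v : Equiv.Perm ℤ} (hv : v ∈ weylB n) {x : ℤ} (hx : |x| ≤ n) :
    |v x| ≤ n := by
  by_contra! h
  have h2 := v.injective (hv.2 _ h)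
  rw [h2] at h
  omega

theorem weylB_eq_of_lt {n : ℕ} {v : Equiv.Perm ℤ} (hv : v ∈ weylB n) {x : ℤ} (hx : (n : ℤ) < x) :
    v x = x :=
  hv.2 x (hx.trans_le (le_abs_self x))

theorem ext_of_nonneg {n : ℕ} {u v : Equiv.Perm ℤ} (hu : u ∈ weylB n) (hv : v ∈ weylB n)
    (h : ∀ x : ℤ, 0 < x → x ≤ n → u x = v x) : u = v := by
  have key : ∀ x : ℤ, 0 ≤ x → u x = v x := by
    intro x hx
    rcases hx.eq_or_lt with rfl | hx
    · rw [weylB_zero hu, weylB_zero hv]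
    rcases le_or_gt x n with h1 | h1
    · exact h x hx h1
    · rw [weylB_eq_of_lt hu h1, weylB_eq_of_lt hv h1]
  ext x
  rcases le_total 0 x with hx | hx
  · exact key x hx
  · have := key (-x) (by omega)
    rw [weylB_neg hu, weylB_neg hv] at this
    omega

/-- The pairing of `v` with the identity, which grows when `v` gets closer to the identity. -/
noncomputable def pairing (n : ℕ) (v : Equiv.Perm ℤ) : ℤ := ∑ x ∈ Finset.Icc (-n : ℤ) n, x * v x

theorem pairing_le (n : ℕ) {v : Equiv.Perm ℤ} (hv : v ∈ weylB n) :
    pairing n v ≤ ∑ _x ∈ Finset.Icc (-n : ℤ) n, (n * n : ℤ) := by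
  refine Finset.sum_le_sum fun x hx => ?_
  have hx' : |x| ≤ n := abs_le.2 (Finset.mem_Icc.1 hx)
  have := weylB_abs_le hv hx'
  calc x * v x ≤ |x * v x| := le_abs_self _
    _ = |x| * |v x| := abs_mul _ _
    _ ≤ n * n := mul_le_mul hx' this (abs_nonneg _) (by positivity)

/-- `s` is an involution of `W(B_n)` that makes `v` more increasing. -/
def IsDescent (n : ℕ) (v s : Equiv.Perm ℤ) : Prop :=
  s ∈ weylB n ∧ s * s = 1 ∧ s ≠ 1 ∧ ∀ x, x < s x → v (s x) < v x

theorem pairing_lt {n : ℕ} {v s : Equiv.Perm ℤ} (h : IsDescent n v s) :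
    pairing n v < pairing n (v * s) := by
  obtain ⟨hs, hss, hs1, hd⟩ := h
  have hinv : ∀ x, s (s x) = x := fun x => by
    have := congrArg (fun f : Equiv.Perm ℤ => f x) hss
    simpa using this
  have hmem : ∀ x, x ∈ Finset.Icc (-n : ℤ) n → s x ∈ Finset.Icc (-n : ℤ) n := fun x hx =>
    Finset.mem_Icc.2 (abs_le.1 (weylB_abs_le hs (abs_le.2 (Finset.mem_Icc.1 hx))))
  have reindex : ∀ f : ℤ → ℤ, ∑ x ∈ Finset.Icc (-n : ℤ) n, f (s x)
      = ∑ x ∈ Finset.Icc (-n : ℤ) n, f x := fun f =>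
    Finset.sum_bij' (fun x _ => s x) (fun x _ => s x) hmem hmem (fun x _ => hinv x)
      (fun x _ => hinv x) (fun x _ => rfl)
  have h1 := reindex fun x => x * v x
  have h2 := reindex fun x => x * v (s x)
  simp only [hinv] at h2
  have hterm : ∀ x, s x ≠ x → 0 < (x - s x) * (v (s x) - v x) := by
    intro x hx
    rcases lt_or_gt_of_ne hx with h | h
    · have := hd (s x) (by rwa [hinv])
      rw [hinv] at this
      exact mul_pos (by omega) (by omega)
    · have := hd x h
      exact mul_pos_of_neg_of_neg (by omega) (by omega)
  have hpos : 0 < ∑ x ∈ Finset.Icc (-n : ℤ) n, (x - s x) * (v (s x) - v x) := by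
    refine Finset.sum_pos' (fun x _ => ?_) ?_
    · by_cases hx : s x = x
      · simp [hx]
      · exact (hterm x hx).le
    · obtain ⟨x, hx⟩ : ∃ x, s x ≠ x := by
        by_contra! hall
        exact hs1 (Equiv.ext hall)
      refine ⟨x, Finset.mem_Icc.2 (abs_le.1 ?_), hterm x hx⟩
      by_contra! hlt
      exact hx (hs.2 x hlt)
  -- By `h1` and `h2` the four sums agree in pairs, so the positive quantity is twice `pairing n (v
  -- * s) - pairing n v`.
  have hexp : ∑ x ∈ Finset.Icc (-n : ℤ) n, (x - s x) * (v (s x) - v x)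
      = ∑ x ∈ Finset.Icc (-n : ℤ) n, x * v (s x) - ∑ x ∈ Finset.Icc (-n : ℤ) n, x * v x
        - ∑ x ∈ Finset.Icc (-n : ℤ) n, s x * v (s x)
        + ∑ x ∈ Finset.Icc (-n : ℤ) n, s x * v x := by
    rw [← Finset.sum_sub_distrib, ← Finset.sum_sub_distrib, ← Finset.sum_add_distrib]
    exact Finset.sum_congr rfl fun x _ => by ring
  simp only [pairing, Equiv.Perm.mul_apply]
  linarith

/-- Sorting: if every element of `C` outside `K` has a descent in `T`, then every element of `C`
is moved into `K` by an element of `⟨T⟩`. -/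
theorem exists_mul_mem_of_descents {n : ℕ} {C : Subgroup (Equiv.Perm ℤ)} (hC : C ≤ weylB n)
    {T K : Set (Equiv.Perm ℤ)} (hT : T ⊆ C)
    (h : ∀ v ∈ C, v ∉ K → ∃ s ∈ T, IsDescent n v s) :
    ∀ v ∈ C, ∃ u ∈ Subgroup.closure T, v * u ∈ K := by
  set M := ∑ _x ∈ Finset.Icc (-n : ℤ) n, (n * n : ℤ) with hM
  -- Induction on the distance of the pairing from its upper bound `M`; the case `d = 0` contradicts
  -- that bound.
  have key : ∀ d : ℕ, ∀ v ∈ C, M - pairing n v < d →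
      ∃ u ∈ Subgroup.closure T, v * u ∈ K := by
    intro d
    induction d with
    | zero =>
      intro v hv hlt
      have := pairing_le n (hC hv)
      push_cast at hlt
      omega
    | succ d ih =>
      intro v hv hlt
      by_cases hK : v ∈ K
      · exact ⟨1, one_mem _, by simpa using hK⟩
      obtain ⟨s, hsT, hs⟩ := h v hv hK
      have hp := pairing_lt hs
      obtain ⟨u, hu, huK⟩ := ih (v * s) (mul_mem hv (hT hsT)) (by push_cast at hlt; omega)
      exact ⟨s * u, mul_mem (Subgroup.subset_closure hsT) hu, by rwa [← mul_assoc]⟩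
  intro v hv
  exact key (M - pairing n v + 1).toNat v hv (by have := pairing_le n (hC hv); omega)

/-! ### Coxeter generators as descents -/

/-- The Coxeter generators numbered from `0`, where the generator `0` is `(1)⁻`. -/
def coxGen : ℕ → Equiv.Perm ℤ
  | 0 => negCycle [1]
  | i + 1 => posCycle [((i + 1 : ℕ) : ℤ), ((i + 1 : ℕ) : ℤ) + 1]

theorem mem_simpleReflections {n : ℕ} {s : Equiv.Perm ℤ} :
    s ∈ simpleReflections n ↔ ∃ i < n, s = coxGen i := by
  constructor
  · rintro (⟨hn, rfl⟩ | ⟨i, hi, hin, rfl⟩)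
    · exact ⟨0, hn, rfl⟩
    · obtain ⟨i, rfl⟩ := Nat.exists_eq_add_of_le' hi
      exact ⟨i + 1, hin, rfl⟩
  · rintro ⟨_ | i, hi, rfl⟩
    · exact Or.inl ⟨hi, rfl⟩
    · exact Or.inr ⟨i + 1, by omega, hi, rfl⟩

theorem coxGen_zero_apply (x : ℤ) : coxGen 0 x = if x = 1 then -1 else if x = -1 then 1 else x := by
  simp [coxGen, negCycle, Equiv.swap_apply_def]

theorem coxGen_apply {i : ℕ} (hi : i ≠ 0) (x : ℤ) : coxGen i x =
    if x = i then (i : ℤ) + 1 else if x = i + 1 then (i : ℤ) else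
    if x = -i then -(i : ℤ) - 1 else if x = -i - 1 then -(i : ℤ) else x := by
  obtain ⟨i, rfl⟩ := Nat.exists_eq_succ_of_ne_zero hi
  simp only [coxGen, posCycle, List.map, List.formPerm_pair, Equiv.Perm.mul_apply,
    Equiv.swap_apply_def]
  split_ifs <;> push_cast at * <;> omega

theorem coxGen_involutive (i : ℕ) (x : ℤ) : coxGen i (coxGen i x) = x := by
  rcases eq_or_ne i 0 with rfl | hi
  · rw [coxGen_zero_apply x]
    split_ifs <;> rw [coxGen_zero_apply] <;> split_ifs <;> first | contradiction | omega
  · rw [coxGen_apply hi x]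
    split_ifs <;> rw [coxGen_apply hi] <;> split_ifs <;> omega

theorem coxGen_mul_self (i : ℕ) : coxGen i * coxGen i = 1 :=
  Equiv.ext fun x => coxGen_involutive i x

theorem coxGen_inv (i : ℕ) : (coxGen i)⁻¹ = coxGen i :=
  inv_eq_of_mul_eq_one_left (coxGen_mul_self i)

theorem coxGen_mem {n i : ℕ} (hi : i < n) : coxGen i ∈ weylB n := by
  rcases eq_or_ne i 0 with rfl | h0
  · refine ⟨fun x => ?_, fun x hx => ?_⟩
    · simp only [coxGen_zero_apply]; split_ifs <;> omega
    · rw [lt_abs] at hx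
      simp only [coxGen_zero_apply]; split_ifs <;> omega
  · refine ⟨fun x => ?_, fun x hx => ?_⟩
    · simp only [coxGen_apply h0]; split_ifs <;> omega
    · rw [lt_abs] at hx
      simp only [coxGen_apply h0]; split_ifs <;> omega

theorem coxGen_apply_succ_le (i : ℕ) : coxGen i (i + 1) ≤ i := by
  rcases eq_or_ne i 0 with rfl | hi
  · simp [coxGen_zero_apply]
  · simp only [coxGen_apply hi]; split_ifs <;> omega

theorem coxGen_ne_one (i : ℕ) : coxGen i ≠ 1 := by
  intro h
  have := coxGen_apply_succ_le i
  rw [h, Equiv.Perm.one_apply] at this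
  omega

/-- Since `v 0 = 0`, the case `i = 0` is covered too: the hypothesis then says `v 1 < 0`. -/
theorem isDescent_coxGen {n i : ℕ} (hi : i < n) {v : Equiv.Perm ℤ} (hv : v ∈ weylB n)
    (h : v (i + 1) < v i) : IsDescent n v (coxGen i) := by
  refine ⟨coxGen_mem hi, coxGen_mul_self i, coxGen_ne_one i, fun x => ?_⟩
  rcases eq_or_ne i 0 with rfl | h0
  · simp only [Nat.cast_zero, zero_add, weylB_zero hv] at h
    have := weylB_neg hv 1
    rw [coxGen_zero_apply]
    split_ifs with h1 h2
    · omega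
    · subst h2; omega
    · simp
  · have h3 := weylB_neg hv i
    have h4 := weylB_neg hv (i + 1)
    rw [coxGen_apply h0]
    split_ifs with h1 h2 h5 h6
    · subst h1; exact fun _ => h
    · omega
    · omega
    · subst h6
      intro
      rw [neg_add'] at h4
      omega
    · simp

/-! ### Cuts preserved by a signed permutation -/

/-- `w` maps the integers greater than `i` onto themselves. -/
def PreservesAbove (i : ℕ) (w : Equiv.Perm ℤ) : Prop := ∀ x : ℤ, (i : ℤ) < w x ↔ (i : ℤ) < x

theorem PreservesAbove.one (i : ℕ) : PreservesAbove i 1 := fun _ => Iff.rfl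

theorem PreservesAbove.mul {i : ℕ} {v w : Equiv.Perm ℤ} (hv : PreservesAbove i v)
    (hw : PreservesAbove i w) : PreservesAbove i (v * w) :=
  fun x => (hv (w x)).trans (hw x)

theorem PreservesAbove.inv {i : ℕ} {v : Equiv.Perm ℤ} (hv : PreservesAbove i v) :
    PreservesAbove i v⁻¹ := fun x => by
  rw [← hv, Equiv.Perm.coe_inv, Equiv.apply_symm_apply]

theorem PreservesAbove.pow {i : ℕ} {v : Equiv.Perm ℤ} (hv : PreservesAbove i v) (e : ℕ) :
    PreservesAbove i (v ^ e) := by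
  induction e with
  | zero => exact PreservesAbove.one i
  | succ e ih => rw [pow_succ]; exact ih.mul hv

/-- An injective map of the finite interval `(i, n]` into itself is onto, so nothing from outside
can enter it. -/
theorem PreservesAbove.of_lt {n i : ℕ} {v : Equiv.Perm ℤ} (hv : v ∈ weylB n)
    (h : ∀ x : ℤ, (i : ℤ) < x → x ≤ n → (i : ℤ) < v x) : PreservesAbove i v := by
  have hm : Set.MapsTo v (Finset.Ioc (i : ℤ) n) (Finset.Ioc (i : ℤ) n) := by
    intro x hx
    simp only [Finset.coe_Ioc, Set.mem_Ioc] at hx ⊢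
    refine ⟨h x hx.1 hx.2, (le_abs_self _).trans (weylB_abs_le hv ?_)⟩
    rw [abs_le]
    omega
  have hsurj := Finset.surjOn_of_injOn_of_card_le v hm v.injective.injOn le_rfl
  intro x
  constructor
  · intro hx
    rcases le_or_gt (v x) n with h1 | h1
    · obtain ⟨y, hy, hyx⟩ := hsurj (Finset.mem_coe.2 (Finset.mem_Ioc.2 ⟨hx, h1⟩))
      rw [← v.injective hyx]
      exact (Finset.mem_Ioc.1 hy).1
    · have := v.injective (weylB_eq_of_lt hv h1)
      omega
  · intro hx
    rcases le_or_gt x n with h1 | h1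
    · exact h x hx h1
    · rw [weylB_eq_of_lt hv h1]; exact hx

theorem preservesAbove_coxGen {i j : ℕ} (h : j ≠ i) : PreservesAbove i (coxGen j) := by
  intro x
  rcases eq_or_ne j 0 with rfl | hj
  · rw [coxGen_zero_apply]; split_ifs <;> omega
  · rw [coxGen_apply hj]; split_ifs <;> omega

theorem not_preservesAbove_coxGen (i : ℕ) : ¬PreservesAbove i (coxGen i) := by
  intro h
  have h1 := (h (i + 1)).2 (by omega)
  have := coxGen_apply_succ_le i
  omega

theorem PreservesAbove.list_prod {i : ℕ} {l : List (Equiv.Perm ℤ)}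
    (h : ∀ s ∈ l, PreservesAbove i s) : PreservesAbove i l.prod := by
  induction l with
  | nil => exact PreservesAbove.one i
  | cons s l ih =>
    rw [List.prod_cons]
    exact (h s List.mem_cons_self).mul (ih fun t ht => h t (List.mem_cons_of_mem _ ht))

/-- Climbing strictly from `v 0 = 0` gives `a ≤ v a`; descending strictly from `v n ≤ n` gives `v a
≤ a`. -/
theorem eq_one_of_forall_lt {n : ℕ} {v : Equiv.Perm ℤ} (hv : v ∈ weylB n)
    (h : ∀ a : ℕ, a < n → v a < v (a + 1)) : v = 1 := by
  have hmono : ∀ a : ℕ, v a < v (a + 1) := by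
    intro a
    rcases lt_or_ge a n with ha | ha
    · exact h a ha
    · rw [weylB_eq_of_lt hv (x := (a : ℤ) + 1) (by omega)]
      rcases ha.eq_or_lt with rfl | ha
      · have := (abs_le.1 (weylB_abs_le hv (x := n) (by simp))).2
        omega
      · rw [weylB_eq_of_lt hv (by omega)]; omega
  have hge : ∀ a : ℕ, (a : ℤ) ≤ v a := by
    intro a
    induction a with
    | zero => simp [weylB_zero hv]
    | succ a ih => have := hmono a; push_cast; omega
  have hle : ∀ d a : ℕ, a + d = n → v a ≤ a := by
    intro d
    induction d with
    | zero =>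
      rintro a rfl
      simpa using (abs_le.1 (weylB_abs_le hv (x := a) (by simp))).2
    | succ d ih =>
      intro a ha
      have h1 := ih (a + 1) (by omega)
      have h2 := hmono a
      push_cast at h1
      omega
  refine ext_of_nonneg hv (one_mem _) fun x hx hxn => ?_
  lift x to ℕ using hx.le
  exact le_antisymm (hle (n - x) x (by omega)) (hge x)

theorem exists_descent {n : ℕ} {v : Equiv.Perm ℤ} (hv : v ∈ weylB n) (h1 : v ≠ 1) :
    ∃ a < n, v ((a : ℤ) + 1) < v a := by
  by_contra! h
  refine h1 (eq_one_of_forall_lt hv fun a ha => (h a ha).lt_of_ne fun he => ?_)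
  have := v.injective he
  omega

/-! ### Deodhar's lemma and the support of reduced expressions -/

/-- The minimal coset representatives of the maximal parabolic subgroup without generator `i`. -/
def IsMinRep (n i : ℕ) (d : Equiv.Perm ℤ) : Prop :=
  d ∈ weylB n ∧ ∀ a < n, a ≠ i → d a < d (a + 1)

/-- A Coxeter generator can reverse the order of two values only if it exchanges them, apart from
the cases of `(1)⁻` involving `0`. Thus the values at `a` and `a + 1` are `j, j + 1` or `-j - 1,
-j`, or `a = j = 0` and `d 1 = 1`; in each case `d` conjugates generator `a` to generator `j`. -/
theorem mul_coxGen_eq {n a j : ℕ} (ha : a < n) (hj : j < n) {d : Equiv.Perm ℤ} (hd : d ∈ weylB n)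
    (h : d a < d (a + 1)) (h' : coxGen j (d (a + 1)) < coxGen j (d a)) :
    coxGen j * d = d * coxGen a := by
  -- Excludes the values `-1, 1`, which `coxGen 0` would reverse.
  have hne : d a ≠ -d (a + 1) := fun he => by
    rw [← weylB_neg hd] at he
    have := d.injective he
    omega
  refine ext_of_nonneg (mul_mem (coxGen_mem hj) hd) (mul_mem hd (coxGen_mem ha))
    fun x hx _ => ?_
  simp only [Equiv.Perm.mul_apply]
  have inj : ∀ y, d x = d y → x = y := fun y hy => d.injective hy
  have inj' : ∀ y, d x = - d y → x = -y := fun y hy => d.injective (by rw [weylB_neg hd, hy])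
  have i1 := inj a
  have i2 := inj (a + 1)
  have i3 := inj' a
  have i4 := inj' (a + 1)
  rcases eq_or_ne a 0 with rfl | h0
  · simp only [Nat.cast_zero, zero_add, weylB_zero hd] at *
    have hc0 : coxGen j 0 = 0 := weylB_zero (coxGen_mem hj)
    rw [hc0] at h'
    have hj0 : j = 0 := by
      by_contra hj0
      rw [coxGen_apply hj0] at h'
      split_ifs at h' <;> omega
    subst hj0
    rw [coxGen_zero_apply] at h'
    have hd1 : d 1 = 1 := by split_ifs at h' <;> omega
    rw [hd1] at i2 i4
    by_cases hx1 : x = 1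
    · subst hx1
      simp [coxGen_zero_apply, hd1, weylB_neg hd]
    · rw [coxGen_zero_apply (d x), coxGen_zero_apply x, if_neg (by omega), if_neg (by omega),
        if_neg hx1, if_neg (by omega)]
  · have hne0 : d a ≠ 0 := fun he => by
      rw [← weylB_zero hd] at he
      have := d.injective he
      omega
    have hne1 : d (a + 1) ≠ 0 := fun he => by
      rw [← weylB_zero hd] at he
      have := d.injective he
      omega
    rw [coxGen_apply h0]
    rcases eq_or_ne j 0 with rfl | hj0
    · rw [coxGen_zero_apply, coxGen_zero_apply] at h'
      split_ifs at h' <;> omega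
    · have hcase : (d a = j ∧ d (a + 1) = j + 1) ∨ (d a = -j - 1 ∧ d (a + 1) = -j) := by
        rw [coxGen_apply hj0, coxGen_apply hj0] at h'
        split_ifs at h' <;> omega
      rw [coxGen_apply hj0]
      rcases hcase with ⟨e1, e2⟩ | ⟨e1, e2⟩ <;> rw [e1] at i1 i3 <;> rw [e2] at i2 i4
      · by_cases hxa : x = a
        · subst hxa; simp [e1, e2]
        by_cases hxb : x = a + 1
        · subst hxb; simp [e1, e2]
        rw [if_neg hxa, if_neg hxb]
        split_ifs <;> omega
      · by_cases hxa : x = a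
        · subst hxa; rw [if_pos rfl, e1, e2]; split_ifs <;> omega
        by_cases hxb : x = a + 1
        · subst hxb; rw [if_neg hxa, if_pos rfl, e1, e2]; split_ifs <;> omega
        rw [if_neg hxa, if_neg hxb]
        split_ifs <;> omega

/-- Deodhar's lemma for a maximal parabolic subgroup. -/
theorem IsMinRep.coxGen_mul {n i j : ℕ} (hj : j < n) {d : Equiv.Perm ℤ} (hd : IsMinRep n i d) :
    IsMinRep n i (coxGen j * d) ∨ ∃ a < n, a ≠ i ∧ coxGen j * d = d * coxGen a := by
  by_cases h : ∀ a < n, a ≠ i → (coxGen j * d) a < (coxGen j * d) (a + 1)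
  · exact Or.inl ⟨mul_mem (coxGen_mem hj) hd.1, h⟩
  · push Not at h
    obtain ⟨a, ha, hai, hle⟩ := h
    refine Or.inr ⟨a, ha, hai, mul_coxGen_eq ha hj hd.1 (hd.2 a ha hai) ?_⟩
    refine lt_of_le_of_ne hle fun he => ?_
    have := (coxGen j * d).injective he
    omega

/-- Reading the word from the right, each letter is either absorbed into the minimal representative,
at the cost of one letter in `l'`, or passes through it and becomes a letter other than `i`. The
length is kept only if nothing is absorbed, and then `d = 1`. -/
theorem exists_minRep_mul_prod {n i : ℕ} (l : List (Equiv.Perm ℤ))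
    (hl : ∀ s ∈ l, s ∈ simpleReflections n) :
    ∃ d, ∃ l' : List (Equiv.Perm ℤ), IsMinRep n i d ∧ (∀ s ∈ l', ∃ a < n, a ≠ i ∧ s = coxGen a) ∧
      l.prod = d * l'.prod ∧
      (l'.length < l.length ∨ l'.length = l.length ∧ d = 1 ∧
        ∀ s ∈ l, ∃ a < n, a ≠ i ∧ s = coxGen a) := by
  induction l with
  | nil =>
    exact ⟨1, [], ⟨one_mem _, fun a _ _ => by simp⟩, by simp, by simp, by simp⟩
  | cons s l ih =>
    obtain ⟨d, l', hd, hl', hprod, hlen⟩ := ih fun t ht => hl t (List.mem_cons_of_mem _ ht)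
    obtain ⟨j, hj, rfl⟩ := mem_simpleReflections.1 (hl s List.mem_cons_self)
    rcases hd.coxGen_mul hj with h | ⟨a, ha, hai, h⟩
    · refine ⟨_, l', h, hl', by rw [List.prod_cons, hprod, mul_assoc], Or.inl ?_⟩
      rw [List.length_cons]
      omega
    · refine ⟨d, coxGen a :: l', hd, ?_, ?_, ?_⟩
      · intro t ht
        rcases List.mem_cons.1 ht with rfl | ht
        · exact ⟨a, ha, hai, rfl⟩
        · exact hl' t ht
      · rw [List.prod_cons, List.prod_cons, hprod, ← mul_assoc, h, mul_assoc]
      · rcases hlen with hlen | ⟨hlen, rfl, hall⟩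
        · left; simpa using hlen
        · right
          refine ⟨by simpa using hlen, rfl, fun t ht => ?_⟩
          rcases List.mem_cons.1 ht with rfl | ht
          · exact ⟨a, ha, hai, by simpa using h⟩
          · exact hall t ht

/-- In the factorization `w = d * l'.prod` both `w` and `l'.prod` preserve the cut `i`, hence so
does `d`. A minimal representative preserving this cut has no descent at all and equals `1`. So `l'`
is a word for `w`, and minimality of `l` leaves only the case where no letter of `l` was `coxGen i`.
-/
theorem coxGen_notMem_supportJ {n i : ℕ} {w : Equiv.Perm ℤ} (hp : PreservesAbove i w) :
    coxGen i ∉ supportJ n w := by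
  rintro ⟨l, ⟨hl, hprod, hmin⟩, hmem⟩
  obtain ⟨d, l', hd, hl', hprod', hlen⟩ := exists_minRep_mul_prod (i := i) l hl
  have hpl' : PreservesAbove i l'.prod := PreservesAbove.list_prod fun s hs => by
    obtain ⟨a, -, hai, rfl⟩ := hl' s hs
    exact preservesAbove_coxGen hai
  have hpd : PreservesAbove i d := by
    have : d = w * l'.prod⁻¹ := by rw [← hprod, hprod', mul_inv_cancel_right]
    rw [this]
    exact hp.mul hpl'.inv
  have hd1 : d = 1 := eq_one_of_forall_lt hd.1 fun a ha => by
    rcases eq_or_ne a i with rfl | hai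
    · have h1 := (hpd (a + 1)).2 (by omega)
      have h2 := (hpd a).not.2 (by omega)
      omega
    · exact hd.2 a ha hai
  rcases hlen with hlen | ⟨-, -, hall⟩
  · have := hmin l' (fun s hs => by
      obtain ⟨a, ha, -, rfl⟩ := hl' s hs
      exact mem_simpleReflections.2 ⟨a, ha, rfl⟩) (by rw [← hprod, hprod', hd1, one_mul])
    omega
  · obtain ⟨a, -, hai, he⟩ := hall _ hmem
    exact not_preservesAbove_coxGen i (he ▸ preservesAbove_coxGen hai)

theorem mem_closure_simpleReflections {n : ℕ} {w : Equiv.Perm ℤ} (hw : w ∈ weylB n) :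
    w ∈ Subgroup.closure (simpleReflections n) := by
  obtain ⟨u, hu, h1⟩ := exists_mul_mem_of_descents (C := weylB n) le_rfl
    (T := simpleReflections n) (K := {1})
    (fun s hs => by
      obtain ⟨i, hi, rfl⟩ := mem_simpleReflections.1 hs
      exact coxGen_mem hi)
    (fun v hv hv1 => by
      obtain ⟨a, ha, h⟩ := exists_descent hv hv1
      exact ⟨coxGen a, mem_simpleReflections.2 ⟨a, ha, rfl⟩, isDescent_coxGen ha hv h⟩) w hw
  rw [eq_inv_of_mul_eq_one_left (Set.mem_singleton_iff.1 h1)]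
  exact inv_mem hu

theorem exists_isReducedExpr {n : ℕ} {w : Equiv.Perm ℤ} (hw : w ∈ weylB n) :
    ∃ l, IsReducedExpr n w l := by
  have hmem := mem_closure_simpleReflections hw
  rw [← Subgroup.mem_toSubmonoid, Subgroup.closure_toSubmonoid] at hmem
  obtain ⟨l₀, hl₀, hp₀⟩ := Submonoid.exists_list_of_mem_closure hmem
  have hex : ∃ k, ∃ l : List (Equiv.Perm ℤ), (∀ s ∈ l, s ∈ simpleReflections n) ∧
      l.prod = w ∧ l.length = k := by
    refine ⟨_, l₀, fun s hs => ?_, hp₀, rfl⟩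
    rcases hl₀ s hs with h | h
    · exact h
    · obtain ⟨i, hi, he⟩ := mem_simpleReflections.1 (Set.mem_inv.1 h)
      rw [inv_eq_iff_eq_inv, coxGen_inv] at he
      exact mem_simpleReflections.2 ⟨i, hi, he⟩
  classical
  obtain ⟨l, hl, hp, hlen⟩ := Nat.find_spec hex
  exact ⟨l, hl, hp, fun l' hl' hp' => hlen ▸ Nat.find_min' hex ⟨l', hl', hp', rfl⟩⟩

theorem coxGen_mem_supportJ {n i : ℕ} {w : Equiv.Perm ℤ} (hw : w ∈ weylB n)
    (hp : ¬PreservesAbove i w) : coxGen i ∈ supportJ n w := by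
  obtain ⟨l, hl⟩ := exists_isReducedExpr hw
  refine ⟨l, hl, ?_⟩
  by_contra hmem
  refine hp (hl.2.1 ▸ PreservesAbove.list_prod fun s hs => ?_)
  obtain ⟨j, -, rfl⟩ := mem_simpleReflections.1 (hl.1 s hs)
  exact preservesAbove_coxGen fun h => hmem (h ▸ hs)

/-- `J(w)` consists of the generators at the cuts that `w` does not preserve. An element respecting
all cuts of `w` can have descents only at other positions, since a preserved cut `a` forces `v a < v
(a + 1)`; so it is sorted to `1` by generators from `J(w)`. -/
theorem mem_parabolic_supportJ {n : ℕ} {v w : Equiv.Perm ℤ} (hw : w ∈ weylB n) :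
    v ∈ parabolic (supportJ n w) ↔
      v ∈ weylB n ∧ ∀ i, PreservesAbove i w → PreservesAbove i v := by
  let C : Subgroup (Equiv.Perm ℤ) :=
    { carrier := {v | v ∈ weylB n ∧ ∀ i, PreservesAbove i w → PreservesAbove i v}
      one_mem' := ⟨one_mem _, fun i _ => PreservesAbove.one i⟩
      mul_mem' := fun ha hb => ⟨mul_mem ha.1 hb.1, fun i hi => (ha.2 i hi).mul (hb.2 i hi)⟩
      inv_mem' := fun ha => ⟨inv_mem ha.1, fun i hi => (ha.2 i hi).inv⟩ }
  have hJ : supportJ n w ⊆ C := by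
    intro s hs
    obtain ⟨l, hl, hsl⟩ := id hs
    obtain ⟨j, hj, rfl⟩ := mem_simpleReflections.1 (hl.1 s hsl)
    refine ⟨coxGen_mem hj, fun i hi => preservesAbove_coxGen ?_⟩
    rintro rfl
    exact coxGen_notMem_supportJ hi hs
  constructor
  · intro hv
    exact (Subgroup.closure_le C).2 hJ hv
  · intro hv
    obtain ⟨u, hu, h1⟩ := exists_mul_mem_of_descents (C := C) (fun v hv => hv.1)
      (T := supportJ n w) (K := {1}) hJ
      (fun v hv hv1 => by
        obtain ⟨a, ha, h⟩ := exists_descent hv.1 hv1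
        refine ⟨coxGen a, coxGen_mem_supportJ hw fun hp => ?_, isDescent_coxGen ha hv.1 h⟩
        have h1 := (hv.2 a hp (a + 1)).2 (by omega)
        have h2 := (hv.2 a hp a).not.2 (by omega)
        omega) v hv
    rw [eq_inv_of_mul_eq_one_left (Set.mem_singleton_iff.1 h1)]
    exact inv_mem hu

end SignedPerm

/-! ### Cycles on blocks, `t(o, m)` and `s(o, m)` as maps -/

namespace SignedPerm

theorem weylB_mono {m n : ℕ} (h : m ≤ n) : weylB m ≤ weylB n := fun _ hv =>
  ⟨hv.1, fun x hx => hv.2 x (by omega)⟩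

theorem formPerm_map_neg (l : List ℤ) (x : ℤ) :
    (l.map (fun i => -i)).formPerm (-x) = -l.formPerm x := by
  match l with
  | [] => simp
  | [a] => simp
  | a :: b :: l =>
    have ih := formPerm_map_neg (b :: l) x
    simp only [List.map_cons, List.formPerm_cons_cons, Equiv.Perm.mul_apply] at ih ⊢
    rw [ih]
    simp only [Equiv.swap_apply_def]
    split_ifs <;> omega

theorem map_neg_map_neg (l : List ℤ) : (l.map (fun i => -i)).map (fun i => -i) = l := by
  simp

theorem posCycle_commute {l : List ℤ} (hl : ∀ x ∈ l, 0 < x) :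
    Commute l.formPerm (l.map (fun i => -i)).formPerm := by
  refine Equiv.Perm.Disjoint.commute fun x => ?_
  by_cases hx : x ∈ l
  · right
    refine List.formPerm_apply_of_notMem fun h => ?_
    obtain ⟨y, hy, rfl⟩ := List.mem_map.1 h
    have := hl _ hx
    have := hl _ hy
    omega
  · exact Or.inl (List.formPerm_apply_of_notMem hx)

/-- Negation exchanges the two disjoint, hence commuting, factors. -/
theorem posCycle_neg {l : List ℤ} (hl : ∀ x ∈ l, 0 < x) (x : ℤ) :
    posCycle l (-x) = -posCycle l x := by
  conv_rhs => rw [posCycle, (posCycle_commute hl).eq]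
  rw [posCycle, Equiv.Perm.mul_apply, formPerm_map_neg, Equiv.Perm.mul_apply, ← formPerm_map_neg,
    ← formPerm_map_neg, map_neg_map_neg, formPerm_map_neg]

theorem nodup_append_map_neg {l : List ℤ} (hl : ∀ x ∈ l, 0 < x) (hd : l.Nodup) :
    (l ++ l.map (fun i => -i)).Nodup := by
  refine List.nodup_append'.2 ⟨hd, hd.map neg_injective, fun x hx h => ?_⟩
  obtain ⟨y, hy, rfl⟩ := List.mem_map.1 h
  have := hl _ hx
  have := hl _ hy
  omega

/-- Negating the list `l, -l` rotates it by half its length, which does not change the cycle. -/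
theorem negCycle_neg {l : List ℤ} (hl : ∀ x ∈ l, 0 < x) (hd : l.Nodup) (x : ℤ) :
    negCycle l (-x) = -negCycle l x := by
  have hrot : (l.map (fun i => -i) ++ l).formPerm = (l ++ l.map (fun i => -i)).formPerm :=
    (List.formPerm_eq_of_isRotated (nodup_append_map_neg hl hd) List.isRotated_append).symm
  have := formPerm_map_neg (l.map (fun i => -i) ++ l) x
  rw [List.map_append, map_neg_map_neg, hrot] at this
  exact this

theorem posCycle_apply_of_notMem {l : List ℤ} {x : ℤ} (h : x ∉ l) (h' : -x ∉ l) :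
    posCycle l x = x := by
  rw [posCycle, Equiv.Perm.mul_apply, List.formPerm_apply_of_notMem (x := x),
    List.formPerm_apply_of_notMem h]
  intro hx
  obtain ⟨y, hy, rfl⟩ := List.mem_map.1 hx
  exact h' (by simpa using hy)

theorem negCycle_apply_of_notMem {l : List ℤ} {x : ℤ} (h : x ∉ l) (h' : -x ∉ l) :
    negCycle l x = x := by
  refine List.formPerm_apply_of_notMem fun hx => ?_
  rcases List.mem_append.1 hx with hx | hx
  · exact h hx
  · obtain ⟨y, hy, rfl⟩ := List.mem_map.1 hx
    exact h' (by simpa using hy)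

theorem posCycle_pow_apply_getElem {l : List ℤ} (hl : ∀ x ∈ l, 0 < x) (hd : l.Nodup) (j r : ℕ)
    (hr : r < l.length) : (posCycle l ^ j) l[r] =
      l[(r + j) % l.length]'(Nat.mod_lt _ (r.zero_le.trans_lt hr)) := by
  rw [posCycle, (posCycle_commute hl).mul_pow, Equiv.Perm.mul_apply,
    Equiv.Perm.pow_apply_eq_self_of_apply_eq_self (f := (l.map (fun i => -i)).formPerm),
    List.formPerm_pow_apply_getElem _ hd]
  refine List.formPerm_apply_of_notMem fun h => ?_
  obtain ⟨y, hy, hyr⟩ := List.mem_map.1 h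
  have := hl _ hy
  have := hl _ (List.getElem_mem hr)
  omega

theorem negCycle_pow_length_apply {l : List ℤ} (hl : ∀ x ∈ l, 0 < x) (hd : l.Nodup) {x : ℤ}
    (hx : x ∈ l) : (negCycle l ^ l.length) x = -x := by
  obtain ⟨r, hr, rfl⟩ := List.mem_iff_getElem.1 hx
  have h := List.formPerm_pow_apply_getElem _ (nodup_append_map_neg hl hd) l.length r
    (by rw [List.length_append]; omega)
  have hmod : (r + l.length) % (l ++ l.map (fun i => -i)).length = r + l.length := by
    apply Nat.mod_eq_of_lt
    rw [List.length_append, List.length_map]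
    omega
  simp only [hmod, List.getElem_append_left hr] at h
  rw [negCycle, h, List.getElem_append_right (by omega)]
  simp

/-- Pins the index to `ℕ`, which `block` leaves to elaboration. -/
theorem block_eq (o m : ℕ) : block o m = (List.range m).map (fun i : ℕ => (o : ℤ) + i + 1) := by
  simp [block, List.map_eq_flatMap, List.flatMap_assoc]

theorem mem_block {o m : ℕ} {x : ℤ} : x ∈ block o m ↔ (o : ℤ) < x ∧ x ≤ o + m := by
  simp only [block_eq, List.mem_map, List.mem_range]
  constructor
  · rintro ⟨r, hr, rfl⟩; omega
  · intro h; exact ⟨(x - o - 1).toNat, by omega, by omega⟩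

theorem block_pos {o m : ℕ} : ∀ x ∈ block o m, 0 < x := fun x hx => by
  have := (mem_block.1 hx).1
  omega

theorem block_nodup (o m : ℕ) : (block o m).Nodup := by
  rw [block_eq]
  refine List.nodup_range.map fun a b h => ?_
  simpa using h

@[simp] theorem block_length (o m : ℕ) : (block o m).length = m := by simp [block_eq]

theorem block_getElem {o m r : ℕ} (hr : r < (block o m).length) :
    (block o m)[r] = (o : ℤ) + r + 1 := by
  simp [block_eq]

theorem notMem_block_of_abs {o m : ℕ} {x : ℤ} (h : |x| ≤ o ∨ ((o + m : ℕ) : ℤ) < |x|) :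
    x ∉ block o m ∧ -x ∉ block o m := by
  rw [mem_block, mem_block]
  rcases abs_cases x with ⟨h1, _⟩ | ⟨h1, _⟩ <;> rw [h1] at h <;> omega

/-- `c` sends each block to a signed permutation that moves only the points of this block and
their negatives. -/
def IsBlockCycle (c : List ℤ → Equiv.Perm ℤ) : Prop :=
  ∀ o m, c (block o m) ∈ weylB (o + m) ∧ ∀ x : ℤ, |x| ≤ o → c (block o m) x = x

theorem isBlockCycle_posCycle : IsBlockCycle posCycle := fun _ _ =>
  ⟨⟨posCycle_neg block_pos, fun _ hx =>
    have h := notMem_block_of_abs (Or.inr hx)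
    posCycle_apply_of_notMem h.1 h.2⟩, fun _ hx =>
    have h := notMem_block_of_abs (Or.inl hx)
    posCycle_apply_of_notMem h.1 h.2⟩

theorem isBlockCycle_negCycle : IsBlockCycle negCycle := fun o m =>
  ⟨⟨negCycle_neg block_pos (block_nodup o m), fun _ hx =>
    have h := notMem_block_of_abs (Or.inr hx)
    negCycle_apply_of_notMem h.1 h.2⟩, fun _ hx =>
    have h := notMem_block_of_abs (Or.inl hx)
    negCycle_apply_of_notMem h.1 h.2⟩

theorem posCycle_block_pow {o m r : ℕ} (j : ℕ) (hr : r < m) :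
    (posCycle (block o m) ^ j) ((o : ℤ) + r + 1) = (o : ℤ) + ((r + j) % m : ℕ) + 1 := by
  have h := posCycle_pow_apply_getElem block_pos (block_nodup o m) j r (by simpa using hr)
  simp only [block_getElem, block_length] at h
  exact h

theorem negCycle_block_pow {o m : ℕ} {x : ℤ} (h : (o : ℤ) < x) (h' : x ≤ o + m) :
    (negCycle (block o m) ^ m) x = -x := by
  simpa using negCycle_pow_length_apply block_pos (block_nodup o m) (mem_block.2 ⟨h, h'⟩)

theorem lt_abs_apply_of_fixed {f : Equiv.Perm ℤ} {o : ℤ} (h : ∀ x : ℤ, |x| ≤ o → f x = x) {x : ℤ}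
    (hx : o < |x|) : o < |f x| := by
  by_contra! hle
  rw [f.injective (h _ hle)] at hle
  omega

theorem pow_apply_eq_of_eqOn {f g : Equiv.Perm ℤ} {P : ℤ → Prop} (hfg : ∀ x, P x → f x = g x)
    (hg : ∀ x, P x → P (g x)) (e : ℕ) {x : ℤ} (hx : P x) : (f ^ e) x = (g ^ e) x := by
  induction e generalizing x with
  | zero => simp
  | succ e ih =>
    rw [pow_succ, pow_succ, Equiv.Perm.mul_apply, Equiv.Perm.mul_apply, hfg x hx, ih (hg x hx)]

section cyclesProd

variable {c : List ℤ → Equiv.Perm ℤ}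

theorem cyclesProd_mem (hc : IsBlockCycle c) (o : ℕ) (l : List ℕ) :
    cyclesProd c o l ∈ weylB (o + l.sum) := by
  induction l generalizing o with
  | nil => exact one_mem _
  | cons m l ih =>
    have h := ih (o + m)
    rw [List.sum_cons, ← add_assoc]
    exact mul_mem (weylB_mono (by omega) (hc o m).1) h

theorem cyclesProd_apply_of_abs_le (hc : IsBlockCycle c) {o : ℕ} (l : List ℕ) {x : ℤ}
    (hx : |x| ≤ o) : cyclesProd c o l x = x := by
  induction l generalizing o with
  | nil => rfl
  | cons m l ih =>
    rw [cyclesProd, Equiv.Perm.mul_apply, ih (by push_cast; omega), (hc o m).2 x hx]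

theorem cyclesProd_cons_apply_of_lt (hc : IsBlockCycle c) {o m : ℕ} (l : List ℕ) {x : ℤ}
    (hx : ((o + m : ℕ) : ℤ) < |x|) : cyclesProd c o (m :: l) x = cyclesProd c (o + m) l x := by
  rw [cyclesProd, Equiv.Perm.mul_apply]
  exact (hc o m).1.2 _ (lt_abs_apply_of_fixed (fun y hy => cyclesProd_apply_of_abs_le hc l hy) hx)

theorem cyclesProd_cons_apply_of_le (hc : IsBlockCycle c) {o m : ℕ} (l : List ℕ) {x : ℤ}
    (hx : |x| ≤ (o + m : ℕ)) : cyclesProd c o (m :: l) x = c (block o m) x := by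
  rw [cyclesProd, Equiv.Perm.mul_apply, cyclesProd_apply_of_abs_le hc l hx]

theorem cyclesProd_append_apply (hc : IsBlockCycle c) {o m : ℕ} (l₁ l₂ : List ℕ) {x : ℤ}
    (hx : ((o + l₁.sum : ℕ) : ℤ) < |x|) (hx' : |x| ≤ (o + l₁.sum + m : ℕ)) :
    cyclesProd c o (l₁ ++ m :: l₂) x = c (block (o + l₁.sum) m) x := by
  induction l₁ generalizing o with
  | nil => exact cyclesProd_cons_apply_of_le hc l₂ (by simpa using hx')
  | cons a l₁ ih =>
    rw [List.sum_cons, ← add_assoc] at hx hx' ⊢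
    rw [List.cons_append, cyclesProd_cons_apply_of_lt hc _ (by omega), ih hx hx']

/-- The exponent is the length of the block containing `x`: this power goes half way around its
negative cycle. -/
theorem exists_cyclesProd_negCycle_pow (l : List ℕ) {o : ℕ} {x : ℤ} (hx : (o : ℤ) < x)
    (hx' : x ≤ (o + l.sum : ℕ)) : ∃ e : ℕ, (cyclesProd negCycle o l ^ e) x = -x := by
  have hc := isBlockCycle_negCycle
  induction l generalizing o with
  | nil => simp at hx'; omega
  | cons m l ih =>
    have habs : |x| = x := abs_of_pos (by omega)
    rcases le_or_gt x (o + m : ℕ) with h | h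
    · refine ⟨m, ?_⟩
      rw [pow_apply_eq_of_eqOn (P := fun y => |y| ≤ (o + m : ℕ))
        (fun y hy => cyclesProd_cons_apply_of_le hc l hy)
        (fun y hy => weylB_abs_le (hc o m).1 hy) m (by rwa [habs])]
      exact negCycle_block_pow hx (by push_cast at h; exact h)
    · obtain ⟨e, he⟩ := ih h (by rw [List.sum_cons] at hx'; push_cast at hx' ⊢; omega)
      refine ⟨e, ?_⟩
      rw [pow_apply_eq_of_eqOn (P := fun y => ((o + m : ℕ) : ℤ) < |y|)
        (fun y hy => cyclesProd_cons_apply_of_lt hc l hy)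
        (fun y hy => lt_abs_apply_of_fixed (fun z hz => cyclesProd_apply_of_abs_le hc l hz) hy)
        e (by rwa [habs]), he]

end cyclesProd

theorem prod_negCycle_singleton_apply {l : List ℤ} (hl : ∀ x ∈ l, 0 < x) (hd : l.Nodup) (x : ℤ) :
    (l.map (fun i => negCycle [i])).prod x = if x ∈ l ∨ -x ∈ l then -x else x := by
  induction l with
  | nil => simp
  | cons a l ih =>
    have ih' := ih (fun y hy => hl y (List.mem_cons_of_mem _ hy)) hd.of_cons
    have ha := hl a List.mem_cons_self
    have hal := (List.nodup_cons.1 hd).1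
    have hal' : -a ∉ l := fun h => by
      have := hl _ (List.mem_cons_of_mem _ h)
      omega
    rw [List.map_cons, List.prod_cons, Equiv.Perm.mul_apply, ih']
    simp only [negCycle, List.map_cons, List.map_nil, List.cons_append, List.nil_append,
      List.formPerm_pair, List.mem_cons]
    by_cases h1 : x = a
    · subst h1; simp [hal, hal']
    by_cases h2 : -x = a
    · subst h2
      simp only [neg_neg] at *
      simp [hal, hal']
    simp only [h1, h2, false_or]
    apply Equiv.swap_apply_of_ne_of_ne <;> split_ifs <;> omega

theorem blockSign_apply (o m : ℕ) (x : ℤ) :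
    blockSign o m x = if (o : ℤ) < |x| ∧ |x| ≤ o + m then -x else x := by
  rw [blockSign, prod_negCycle_singleton_apply block_pos (block_nodup o m)]
  congr 1
  rw [mem_block, mem_block]
  rcases abs_cases x with ⟨h1, _⟩ | ⟨h1, _⟩ <;> rw [h1] <;> apply propext <;> omega

theorem blockSign_mem {n o m : ℕ} (h : o + m ≤ n) : blockSign o m ∈ weylB n := by
  refine ⟨fun x => ?_, fun x hx => ?_⟩
  · simp only [blockSign_apply, abs_neg]
    split_ifs <;> rfl
  · rw [blockSign_apply, if_neg (by omega)]

theorem blockSwap_mem {n o m : ℕ} (h : o + 2 * m ≤ n) : blockSwap o m ∈ weylB n :=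
  pow_mem (weylB_mono h (isBlockCycle_posCycle o (2 * m)).1) m

theorem blockSwap_apply_left {o m r : ℕ} (hr : r < m) :
    blockSwap o m ((o : ℤ) + r + 1) = o + m + r + 1 := by
  rw [blockSwap, posCycle_block_pow m (by omega), Nat.mod_eq_of_lt (by omega)]
  push_cast
  ring

theorem blockSwap_apply_right {o m r : ℕ} (hr : r < m) :
    blockSwap o m ((o : ℤ) + m + r + 1) = o + r + 1 := by
  have h := posCycle_block_pow (o := o) (m := 2 * m) (r := m + r) m (by omega)
  rw [show m + r + m = r + 2 * m by ring, Nat.add_mod_right, Nat.mod_eq_of_lt (by omega)] at h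
  rw [blockSwap, ← h]
  push_cast
  congr 1
  ring

theorem blockSwap_apply_of_abs {o m : ℕ} {x : ℤ}
    (h : |x| ≤ o ∨ ((o + 2 * m : ℕ) : ℤ) < |x|) : blockSwap o m x = x := by
  have h := notMem_block_of_abs h
  exact Equiv.Perm.pow_apply_eq_self_of_apply_eq_self (posCycle_apply_of_notMem h.1 h.2) _

end SignedPerm

/-! ### Positions of the positive cycles and the action of `w_λ` -/

namespace DoublePartition

open SignedPerm

variable {n : ℕ} (lam : DoublePartition n)

/-- In this form the offset matches the sum of an initial segment of the sorted list of parts. -/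
theorem offset_eq (m : ℕ) : lam.offset m = lam.neg.sum + (lam.pos.filter (· < m)).sum := by
  rw [offset, Finset.sum_multiset_count_of_subset (lam.pos.filter (· < m)) (Finset.Ico 1 m)]
  · congr 1
    refine Finset.sum_congr rfl fun i hi => ?_
    rw [Multiset.count_filter, if_pos (Finset.mem_Ico.1 hi).2, smul_eq_mul, mul_comm, mult]
  · intro i hi
    rw [Multiset.mem_toFinset, Multiset.mem_filter] at hi
    exact Finset.mem_Ico.2 ⟨lam.pos_parts i hi.1, hi.2⟩

theorem offset_succ (m : ℕ) : lam.offset (m + 1) = lam.offset m + lam.mult m * m := by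
  rcases Nat.eq_zero_or_pos m with rfl | hm
  · simp [offset]
  · rw [offset, offset, Finset.sum_Ico_succ_top hm]
    ring

theorem offset_mono : Monotone lam.offset :=
  monotone_nat_of_le_succ fun m => by rw [offset_succ]; exact Nat.le_add_right _ _

theorem le_offset (m : ℕ) : lam.neg.sum ≤ lam.offset m := Nat.le_add_right _ _

theorem offset_succ_self : lam.offset (n + 1) = n := by
  have hsum := lam.sum_eq
  rw [offset_eq, Multiset.filter_eq_self.2 fun m hm => ?_]
  · omega
  · have := Multiset.single_le_sum (fun _ _ => Nat.zero_le _) m hm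
    omega

theorem offset_le (m : ℕ) : lam.offset m ≤ n := by
  have h := congrArg Multiset.sum (Multiset.filter_add_not (· < m) lam.pos)
  have hsum := lam.sum_eq
  rw [Multiset.sum_add] at h
  rw [offset_eq]
  omega

theorem pos_of_mult {m k : ℕ} (hk : k < lam.mult m) : 0 < m :=
  lam.pos_parts m (Multiset.count_pos.1 (by rw [mult] at hk; omega))

theorem block_end_le {m k : ℕ} (hk : k < lam.mult m) :
    lam.offset m + k * m + m ≤ lam.offset (m + 1) := by
  rw [offset_succ]
  have := Nat.mul_le_mul_right m (Nat.succ_le_of_lt hk)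
  rw [Nat.succ_mul] at this
  omega

/-- The point at position `r` of the `k`-th positive cycle of length `m`, all counted from `0`. -/
def point (m k r : ℕ) : ℤ := (lam.offset m + k * m : ℕ) + (r : ℤ) + 1

/-- Distinct positive cycles occupy disjoint intervals: different lengths are separated by
monotonicity of the offsets, equal lengths by multiples of `m`. -/
theorem block_end_le_or {m k m' k' : ℕ} (hk : k < lam.mult m) (hk' : k' < lam.mult m')
    (h : ¬(m = m' ∧ k = k')) :
    lam.offset m + k * m + m ≤ lam.offset m' + k' * m' ∨
      lam.offset m' + k' * m' + m' ≤ lam.offset m + k * m := by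
  have h1 := lam.block_end_le hk
  have h2 := lam.block_end_le hk'
  rcases lt_trichotomy m m' with hm | rfl | hm
  · have := lam.offset_mono (Nat.succ_le_of_lt hm)
    simp only [Nat.succ_eq_add_one] at this
    omega
  · rcases lt_or_gt_of_ne (fun he : k = k' => h ⟨rfl, he⟩) with hlt | hlt
    · have := Nat.mul_le_mul_right m (Nat.succ_le_of_lt hlt)
      rw [Nat.succ_mul] at this
      omega
    · have := Nat.mul_le_mul_right m (Nat.succ_le_of_lt hlt)
      rw [Nat.succ_mul] at this
      omega
  · have := lam.offset_mono (Nat.succ_le_of_lt hm)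
    simp only [Nat.succ_eq_add_one] at this
    omega

theorem point_inj {m k r m' k' r' : ℕ} (hk : k < lam.mult m) (hk' : k' < lam.mult m')
    (hr : r < m) (hr' : r' < m') (h : lam.point m k r = lam.point m' k' r') :
    m = m' ∧ k = k' ∧ r = r' := by
  by_cases hb : m = m' ∧ k = k'
  · obtain ⟨rfl, rfl⟩ := hb
    refine ⟨rfl, rfl, ?_⟩
    simp only [point] at h
    omega
  · have := lam.block_end_le_or hk hk' hb
    simp only [point] at h
    omega

theorem lt_point (m k r : ℕ) : (lam.neg.sum : ℤ) < lam.point m k r := by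
  have := lam.le_offset m
  simp only [point]
  omega

theorem point_pos (m k r : ℕ) : 0 < lam.point m k r := by
  have := lam.lt_point m k r
  omega

theorem point_le {m k r : ℕ} (hk : k < lam.mult m) (hr : r < m) : lam.point m k r ≤ n := by
  have h1 := lam.block_end_le hk
  have h2 := lam.offset_le (m + 1)
  simp only [point]
  omega

theorem exists_point {x : ℤ} (hx : (lam.neg.sum : ℤ) < x) (hxn : x ≤ n) :
    ∃ m k r, k < lam.mult m ∧ r < m ∧ x = lam.point m k r := by
  lift x to ℕ using by omega
  have hex : ∃ m, x ≤ lam.offset m := ⟨n + 1, by rw [offset_succ_self]; omega⟩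
  -- This choice gives `offset m < x ≤ offset (m + 1)`, so `x` lies in a cycle of length `m`;
  -- division with remainder by `m` then finds the cycle and the position. The minimum is not `0`,
  -- because `offset 0 = |λ⁻| < x`.
  obtain ⟨m, hm⟩ : ∃ m, Nat.find hex = m + 1 := by
    refine Nat.exists_eq_succ_of_ne_zero fun h0 => ?_
    have := Nat.find_spec hex
    rw [h0] at this
    simp [offset] at this
    omega
  have h1 := Nat.find_spec hex
  have h2 := Nat.find_min hex (m := m) (by omega)
  rw [hm, offset_succ] at h1
  have hm0 : 0 < m := by
    rcases Nat.eq_zero_or_pos m with rfl | h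
    · omega
    · exact h
  have hdiv := Nat.div_add_mod (x - lam.offset m - 1) m
  refine ⟨m, (x - lam.offset m - 1) / m, (x - lam.offset m - 1) % m, ?_, Nat.mod_lt _ hm0, ?_⟩
  · rw [Nat.div_lt_iff_lt_mul hm0]
    omega
  · rw [mul_comm] at hdiv
    simp only [point]
    omega

theorem abs_cases_point (x : ℤ) : |x| ≤ lam.neg.sum ∨ (n : ℤ) < |x| ∨
    ∃ m k r, k < lam.mult m ∧ r < m ∧ (x = lam.point m k r ∨ x = -lam.point m k r) := by
  by_cases h1 : |x| ≤ lam.neg.sum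
  · exact Or.inl h1
  by_cases h2 : (n : ℤ) < |x|
  · exact Or.inr (Or.inl h2)
  obtain ⟨m, k, r, hk, hr, h⟩ := lam.exists_point (not_le.1 h1) (not_lt.1 h2)
  exact Or.inr (Or.inr ⟨m, k, r, hk, hr, eq_or_eq_neg_of_abs_eq h⟩)

theorem sort_pos_eq (m : ℕ) : lam.pos.sort (· ≤ ·) = (lam.pos.filter (· < m)).sort (· ≤ ·) ++
    (List.replicate (lam.mult m) m ++ (lam.pos.filter (m < ·)).sort (· ≤ ·)) := by
  refine List.Perm.eq_of_pairwise' (r := (· ≤ ·)) (Multiset.pairwise_sort _ _) ?_ ?_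
  · simp only [List.pairwise_append, List.mem_append, Multiset.mem_sort, Multiset.mem_filter,
      List.mem_replicate]
    refine ⟨Multiset.pairwise_sort _ _, ⟨?_, Multiset.pairwise_sort _ _, ?_⟩, ?_⟩
    · exact List.pairwise_replicate.2 (Or.inr le_rfl)
    · rintro a ⟨-, rfl⟩ b ⟨-, hb⟩
      exact hb.le
    · rintro a ⟨-, ha⟩ b (⟨-, rfl⟩ | ⟨-, hb⟩)
      · exact ha.le
      · exact (ha.trans hb).le
  · rw [← Multiset.coe_eq_coe, ← Multiset.coe_add, ← Multiset.coe_add, Multiset.sort_eq,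
      Multiset.sort_eq, Multiset.sort_eq, Multiset.coe_replicate]
    ext i
    simp only [Multiset.count_add, Multiset.count_filter, Multiset.count_replicate, mult]
    rcases lt_trichotomy i m with h | rfl | h
    · simp [h, h.ne', h.not_gt]
    · simp
    · simp [h, h.ne, h.not_gt]

theorem sum_sort (s : Multiset ℕ) : (s.sort (· ≤ ·)).sum = s.sum := by
  rw [← Multiset.sum_coe, Multiset.sort_eq]

theorem rep_mem : lam.rep ∈ weylB n := by
  refine mul_mem (weylB_mono ?_ (cyclesProd_mem isBlockCycle_negCycle _ _))
    (weylB_mono ?_ (cyclesProd_mem isBlockCycle_posCycle _ _))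
  all_goals
    rw [sum_sort]
    have := lam.sum_eq
    omega

theorem rep_apply_of_lt {x : ℤ} (hx : (lam.neg.sum : ℤ) < |x|) :
    lam.rep x = cyclesProd posCycle lam.neg.sum (lam.pos.sort (· ≤ ·)) x := by
  rw [rep, Equiv.Perm.mul_apply]
  have hmem := cyclesProd_mem isBlockCycle_negCycle 0 (lam.neg.sort (· ≤ ·))
  rw [sum_sort, zero_add] at hmem
  exact hmem.2 _ (lt_abs_apply_of_fixed
    (fun y hy => cyclesProd_apply_of_abs_le isBlockCycle_posCycle _ hy) hx)

theorem rep_point {m k r : ℕ} (hk : k < lam.mult m) (hr : r < m) :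
    lam.rep (lam.point m k r) = lam.point m k ((r + 1) % m) := by
  have habs : |lam.point m k r| = lam.point m k r := abs_of_pos (lam.point_pos m k r)
  rw [rep_apply_of_lt _ (by rw [habs]; exact lam.lt_point m k r)]
  -- The prefix holds all shorter parts and the first `k` copies of `m`, so the next block starts
  -- after `offset m + k * m`.
  have hsplit : lam.pos.sort (· ≤ ·) =
      ((lam.pos.filter (· < m)).sort (· ≤ ·) ++ List.replicate k m) ++
        m :: (List.replicate (lam.mult m - k - 1) m ++ (lam.pos.filter (m < ·)).sort (· ≤ ·)) := by
    rw [lam.sort_pos_eq m]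
    have : lam.mult m = k + (lam.mult m - k - 1 + 1) := by omega
    conv_lhs => rw [this, List.replicate_add, List.replicate_succ]
    simp
  have hsum : lam.neg.sum + ((lam.pos.filter (· < m)).sort (· ≤ ·) ++ List.replicate k m).sum
      = lam.offset m + k * m := by
    rw [List.sum_append, sum_sort, List.sum_replicate, offset_eq, smul_eq_mul, add_assoc]
  rw [hsplit, cyclesProd_append_apply isBlockCycle_posCycle, hsum]
  · have := posCycle_block_pow (o := lam.offset m + k * m) 1 hr
    rw [pow_one] at this
    exact this
  · rw [hsum, habs, point]; omega
  · rw [hsum, habs, point]; omega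

theorem exists_rep_pow_eq_neg {x : ℤ} (hx : 0 < x) (hxp : x ≤ lam.neg.sum) :
    ∃ e : ℕ, (lam.rep ^ e) x = -x := by
  obtain ⟨e, he⟩ := exists_cyclesProd_negCycle_pow (lam.neg.sort (· ≤ ·)) (o := 0) (by simpa using hx)
    (by rwa [sum_sort, zero_add])
  have hmem := cyclesProd_mem isBlockCycle_negCycle 0 (lam.neg.sort (· ≤ ·))
  rw [sum_sort, zero_add] at hmem
  refine ⟨e, ?_⟩
  rw [← he]
  refine pow_apply_eq_of_eqOn (P := fun y => |y| ≤ lam.neg.sum) (fun y hy => ?_)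
    (fun y hy => weylB_abs_le hmem hy) e (by rwa [abs_of_pos hx])
  rw [rep, Equiv.Perm.mul_apply, cyclesProd_apply_of_abs_le isBlockCycle_posCycle _ hy]

theorem rep_pow_point {m k r : ℕ} (hk : k < lam.mult m) (hr : r < m) (j : ℕ) :
    (lam.rep ^ j) (lam.point m k r) = lam.point m k ((r + j) % m) := by
  induction j with
  | zero => simp [Nat.mod_eq_of_lt hr]
  | succ j ih =>
    rw [pow_succ', Equiv.Perm.mul_apply, ih, rep_point _ hk (Nat.mod_lt _ (by omega)),
      Nat.mod_add_mod, add_assoc]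

theorem pow_rep_mem (e : ℕ) : lam.rep ^ e ∈ weylB n := pow_mem lam.rep_mem e

/-! ### How centralizing elements act on the cycles -/

section Centralizer

variable {lam} {v : Equiv.Perm ℤ}

theorem apply_rep_pow (hc : Commute v lam.rep) (e : ℕ) (x : ℤ) :
    v ((lam.rep ^ e) x) = (lam.rep ^ e) (v x) := by
  rw [← Equiv.Perm.mul_apply, (hc.pow_right e).eq, Equiv.Perm.mul_apply]

/-- Points of negative cycles are negated by some power of `w_λ`, a property that a centralizing `v`
transports. Points of positive cycles lack it, as powers of `w_λ` keep their sign. -/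
theorem abs_apply_le (hv : v ∈ weylB n) (hc : Commute v lam.rep) {x : ℤ}
    (hx : |x| ≤ lam.neg.sum) : |v x| ≤ lam.neg.sum := by
  have key : ∃ e : ℕ, (lam.rep ^ e) x = -x := by
    rcases lt_trichotomy x 0 with h | rfl | h
    · rw [abs_of_neg h] at hx
      obtain ⟨e, he⟩ := lam.exists_rep_pow_eq_neg (x := -x) (by omega) hx
      rw [weylB_neg (lam.pow_rep_mem e)] at he
      exact ⟨e, by omega⟩
    · exact ⟨0, by simp⟩
    · rw [abs_of_pos h] at hx
      exact lam.exists_rep_pow_eq_neg h hx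
  obtain ⟨e, he⟩ := key
  have h2 : (lam.rep ^ e) (v x) = -v x := by rw [← apply_rep_pow hc, he, weylB_neg hv]
  rcases lam.abs_cases_point (v x) with h | h | ⟨m, k, r, hk, hr, h⟩
  · exact h
  · rw [v.injective (hv.2 _ h)] at h
    have := lam.sum_eq
    omega
  · have hp := lam.rep_pow_point hk hr e
    have h3 := lam.point_pos m k ((r + e) % m)
    have h4 := lam.point_pos m k r
    rcases h with h | h
    · rw [h] at h2; omega
    · rw [h, weylB_neg (lam.pow_rep_mem e)] at h2; omega

theorem lt_abs_apply (hv : v ∈ weylB n) (hc : Commute v lam.rep) {x : ℤ}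
    (hx : (lam.neg.sum : ℤ) < |x|) : (lam.neg.sum : ℤ) < |v x| := by
  by_contra! h
  have := abs_apply_le (inv_mem hv) hc.inv_left h
  rw [Equiv.Perm.coe_inv, Equiv.symm_apply_apply] at this
  omega

/-- An element of the centralizer permutes the positive cycles of each length, up to sign and
rotation. -/
theorem exists_apply_point (hv : v ∈ weylB n) (hc : Commute v lam.rep) {m k : ℕ}
    (hk : k < lam.mult m) : ∃ k' < lam.mult m, ∃ r' < m, ∃ ε : ℤ, (ε = 1 ∨ ε = -1) ∧
      ∀ r < m, v (lam.point m k r) = ε * lam.point m k' ((r' + r) % m) := by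
  have hm := lam.pos_of_mult hk
  obtain ⟨m', k', r', hk', hr', ε, hε, h⟩ : ∃ m' k' r', k' < lam.mult m' ∧ r' < m' ∧
      ∃ ε : ℤ, (ε = 1 ∨ ε = -1) ∧ v (lam.point m k 0) = ε * lam.point m' k' r' := by
    have habs : |lam.point m k 0| = lam.point m k 0 := abs_of_pos (lam.point_pos m k 0)
    rcases lam.abs_cases_point (v (lam.point m k 0)) with h | h | ⟨m', k', r', hk', hr', h | h⟩
    · have := lt_abs_apply hv hc (x := lam.point m k 0) (by rw [habs]; exact lam.lt_point m k 0)
      omega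
    · have := weylB_abs_le hv (x := lam.point m k 0) (by rw [habs]; exact lam.point_le hk hm)
      omega
    · exact ⟨m', k', r', hk', hr', 1, Or.inl rfl, by rw [h, one_mul]⟩
    · exact ⟨m', k', r', hk', hr', -1, Or.inr rfl, by rw [h]; ring⟩
  have hw : ∀ j : ℕ, v (lam.point m k (j % m)) = ε * lam.point m' k' ((r' + j) % m') := by
    intro j
    have := lam.rep_pow_point hk hm j
    rw [zero_add] at this
    rw [← this, apply_rep_pow hc, h, ← lam.rep_pow_point hk' hr' j]
    rcases hε with rfl | rfl
    · simp
    · simp [weylB_neg (lam.pow_rep_mem j)]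
  have hcancel : ∀ a b : ℤ, ε * a = ε * b → a = b := by
    rcases hε with rfl | rfl <;> intro a b <;> omega
  -- The `m`-th power of `w_λ` fixes the source point, hence its image; the converse divisibility
  -- uses the `m'`-th power and injectivity of `v`.
  have hd1 : m' ∣ m := by
    have h1 := hw m
    rw [Nat.mod_self, h] at h1
    have := (lam.point_inj hk' hk' hr' (Nat.mod_lt _ (by omega)) (hcancel _ _ h1)).2.2
    rw [← Nat.modEq_zero_iff_dvd]
    refine Nat.ModEq.add_left_cancel' r' ?_
    rw [add_zero, Nat.ModEq, ← this, Nat.mod_eq_of_lt hr']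
  have hd2 : m ∣ m' := by
    have h1 := hw m'
    rw [Nat.add_mod_right, Nat.mod_eq_of_lt hr', ← h] at h1
    exact Nat.dvd_of_mod_eq_zero
      (lam.point_inj hk hk (Nat.mod_lt _ hm) hm (v.injective h1)).2.2
  obtain rfl := Nat.dvd_antisymm hd1 hd2
  refine ⟨k', hk', r', hr', ε, hε, fun r hr => ?_⟩
  rw [← hw r, Nat.mod_eq_of_lt hr]

/-- If two cycles land in the same cycle with the same sign, a power of `w_λ` joins the images and
hence, by injectivity of `v`, the sources. -/
theorem eq_of_apply_point (hc : Commute v lam.rep) {m k₁ k₂ k r₁ r₂ : ℕ} {ε : ℤ}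
    (hε : ε = 1 ∨ ε = -1) (hk₁ : k₁ < lam.mult m) (hk₂ : k₂ < lam.mult m) (hk : k < lam.mult m)
    (hr₁ : r₁ < m) (hr₂ : r₂ < m) (h₁ : v (lam.point m k₁ 0) = ε * lam.point m k r₁)
    (h₂ : v (lam.point m k₂ 0) = ε * lam.point m k r₂) : k₁ = k₂ := by
  have hm := lam.pos_of_mult hk
  -- This exponent rotates `r₁` to `r₂`; adding `m` avoids truncated subtraction.
  have h3 := lam.rep_pow_point hk hr₁ (r₂ + m - r₁)
  rw [show r₁ + (r₂ + m - r₁) = r₂ + m by omega, Nat.add_mod_right, Nat.mod_eq_of_lt hr₂] at h3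
  have h4 : v ((lam.rep ^ (r₂ + m - r₁)) (lam.point m k₁ 0)) = v (lam.point m k₂ 0) := by
    rw [apply_rep_pow hc, h₁, h₂, ← h3]
    rcases hε with rfl | rfl
    · simp
    · simp [weylB_neg (lam.pow_rep_mem _)]
  rw [rep_pow_point _ hk₁ hm] at h4
  exact (lam.point_inj hk₁ hk₂ (Nat.mod_lt _ hm) hm (v.injective h4)).2.1

end Centralizer

/-! ### Membership in `W_J` and unrotated block permutations -/

theorem preservesAbove_rep {m k : ℕ} (hk : k < lam.mult m) :
    PreservesAbove (lam.offset m + k * m) lam.rep ∧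
      PreservesAbove (lam.offset m + k * m + m) lam.rep := by
  have := lam.le_offset m
  constructor <;> refine PreservesAbove.of_lt lam.rep_mem fun x hx hxn => ?_ <;>
    obtain ⟨m', k', r', hk', hr', rfl⟩ := lam.exists_point (by omega) hxn <;>
    rw [rep_point _ hk' hr'] <;> by_cases hb : m = m' ∧ k = k'
  · obtain ⟨rfl, rfl⟩ := hb
    simp only [point]; omega
  · have := lam.block_end_le_or hk hk' hb
    simp only [point] at *; omega
  · obtain ⟨rfl, rfl⟩ := hb
    simp only [point] at *; omega
  · have := lam.block_end_le_or hk hk' hb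
    simp only [point] at *; omega

/-- The parabolic subgroup `W_J` for `J = J(w_λ)` stabilizes each positive cycle of `w_λ`. -/
theorem apply_point_of_mem_parabolic {v : Equiv.Perm ℤ}
    (hv : v ∈ parabolic (supportJ n lam.rep)) {m k r : ℕ} (hk : k < lam.mult m) (hr : r < m) :
    ((lam.offset m + k * m : ℕ) : ℤ) < v (lam.point m k r) ∧
      v (lam.point m k r) ≤ (lam.offset m + k * m + m : ℕ) := by
  have h := ((mem_parabolic_supportJ lam.rep_mem).1 hv).2
  have h1 := (h _ (lam.preservesAbove_rep hk).1 (lam.point m k r)).2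
  have h2 := (h _ (lam.preservesAbove_rep hk).2 (lam.point m k r)).1
  refine ⟨h1 ?_, le_of_not_gt fun h3 => ?_⟩
  · simp only [point]; omega
  · have := h2 h3
    simp only [point] at this; omega

/-- A lower bound suffices. A cut of `w_λ` cannot lie below `|λ⁻|` or strictly inside a positive
cycle, so a point above the cut has its whole cycle above it, and its image exceeds the start of
that cycle. -/
theorem mem_parabolic_of_apply_point {v : Equiv.Perm ℤ} (hv : v ∈ weylB n)
    (h : ∀ m k r, k < lam.mult m → r < m →
      ((lam.offset m + k * m : ℕ) : ℤ) < v (lam.point m k r)) :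
    v ∈ parabolic (supportJ n lam.rep) := by
  refine (mem_parabolic_supportJ lam.rep_mem).2 ⟨hv, fun i hi => ?_⟩
  have hip : lam.neg.sum ≤ i := by
    by_contra! hlt
    obtain ⟨e, he⟩ := lam.exists_rep_pow_eq_neg (x := lam.neg.sum) (by omega) le_rfl
    have := (hi.pow e lam.neg.sum).2 (by omega)
    omega
  refine PreservesAbove.of_lt hv fun x hx hxn => ?_
  obtain ⟨m, k, r, hk, hr, rfl⟩ := lam.exists_point (by omega) hxn
  have h1 := h m k r hk hr
  by_contra! h2
  -- `w_λ` sends the last point of the cycle to the first, so a cut below the last point is also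
  -- below the first.
  have h3 := (hi (lam.point m k (m - 1))).2 (by simp only [point] at *; omega)
  rw [rep_point _ hk (by omega), Nat.sub_add_cancel (by omega), Nat.mod_self] at h3
  simp only [point] at h3
  omega

/-- `v` permutes the positive cycles of `w_λ` of each length up to sign, without rotating them,
and fixes the points of the negative cycles. -/
def IsBlockPerm (v : Equiv.Perm ℤ) : Prop :=
  v ∈ weylB n ∧ (∀ x : ℤ, |x| ≤ lam.neg.sum → v x = x) ∧
    ∀ m k, k < lam.mult m → ∃ k' < lam.mult m, ∃ ε : ℤ, (ε = 1 ∨ ε = -1) ∧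
      ∀ r < m, v (lam.point m k r) = ε * lam.point m k' r

variable {lam}

theorem isBlockPerm_one : lam.IsBlockPerm 1 :=
  ⟨one_mem _, fun _ _ => rfl, fun _ k hk => ⟨k, hk, 1, Or.inl rfl, fun _ _ => by simp⟩⟩

theorem IsBlockPerm.mul {u v : Equiv.Perm ℤ} (hu : lam.IsBlockPerm u) (hv : lam.IsBlockPerm v) :
    lam.IsBlockPerm (u * v) := by
  refine ⟨mul_mem hu.1 hv.1, fun x hx => ?_, fun m k hk => ?_⟩
  · rw [Equiv.Perm.mul_apply, hv.2.1 x hx, hu.2.1 x hx]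
  · obtain ⟨k', hk', ε, hε, h⟩ := hv.2.2 m k hk
    obtain ⟨k'', hk'', ε', hε', h'⟩ := hu.2.2 m k' hk'
    refine ⟨k'', hk'', ε * ε', by rcases hε with rfl | rfl <;> simpa [or_comm, neg_eq_iff_eq_neg]
      using hε', fun r hr => ?_⟩
    rw [Equiv.Perm.mul_apply, h r hr]
    rcases hε with rfl | rfl
    · rw [one_mul, one_mul, h' r hr]
    · rw [neg_one_mul, weylB_neg hu.1, h' r hr]
      ring

theorem IsBlockPerm.commute {v : Equiv.Perm ℤ} (hv : lam.IsBlockPerm v) : Commute v lam.rep := by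
  refine ext_of_nonneg (mul_mem hv.1 lam.rep_mem) (mul_mem lam.rep_mem hv.1) fun x hx hxn => ?_
  rw [Equiv.Perm.mul_apply, Equiv.Perm.mul_apply]
  rcases le_or_gt x lam.neg.sum with h | h
  · have habs : |x| ≤ lam.neg.sum := by rwa [abs_of_pos hx]
    rw [hv.2.1 x habs, hv.2.1 _ (abs_apply_le lam.rep_mem (Commute.refl _) habs)]
  · obtain ⟨m, k, r, hk, hr, rfl⟩ := lam.exists_point h hxn
    obtain ⟨k', hk', ε, hε, h⟩ := hv.2.2 m k hk
    rw [rep_point _ hk hr, h _ (Nat.mod_lt _ (by omega)), h r hr]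
    rcases hε with rfl | rfl
    · rw [one_mul, one_mul, rep_point _ hk' hr]
    · rw [neg_one_mul, neg_one_mul, weylB_neg lam.rep_mem, rep_point _ hk' hr]

/-- `W_J` keeps each positive cycle inside its own interval, which forces the sign `1` and the same
cycle; without rotation every point is then fixed. -/
theorem IsBlockPerm.eq_one {v : Equiv.Perm ℤ} (hv : lam.IsBlockPerm v)
    (hp : v ∈ parabolic (supportJ n lam.rep)) : v = 1 := by
  refine ext_of_nonneg hv.1 (one_mem _) fun x hx hxn => ?_
  rw [Equiv.Perm.one_apply]
  rcases le_or_gt x lam.neg.sum with h | h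
  · exact hv.2.1 x (by rwa [abs_of_pos hx])
  · obtain ⟨m, k, r, hk, hr, rfl⟩ := lam.exists_point h hxn
    obtain ⟨k', hk', ε, hε, h⟩ := hv.2.2 m k hk
    have h1 := lam.apply_point_of_mem_parabolic hp hk hr
    have h2 := lam.point_pos m k' r
    rw [h r hr] at h1 ⊢
    rcases hε with rfl | rfl
    · rw [one_mul] at h1 ⊢
      by_cases hkk : k = k'
      · rw [hkk]
      · have := lam.block_end_le_or hk hk' (fun h => hkk h.2)
        simp only [point] at h1
        omega
    · omega

end DoublePartition

/-! ### The generators of `N_λ` as block permutations and as descents -/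

namespace DoublePartition

open SignedPerm

variable {n : ℕ} {lam : DoublePartition n}

theorem isBlockPerm_blockSign {m : ℕ} (h0 : 0 < lam.mult m) :
    lam.IsBlockPerm (blockSign (lam.offset m) m) := by
  have hle := lam.block_end_le h0
  have hn := lam.offset_le (m + 1)
  have hp := lam.le_offset m
  refine ⟨blockSign_mem (by omega), fun x hx => ?_, fun m' k' hk' => ?_⟩
  · rw [blockSign_apply, if_neg (by omega)]
  · refine ⟨k', hk', if m = m' ∧ 0 = k' then -1 else 1, by split_ifs <;> simp, fun r hr => ?_⟩
    rw [blockSign_apply, abs_of_pos (lam.point_pos m' k' r)]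
    by_cases hb : m = m' ∧ 0 = k'
    · obtain ⟨rfl, rfl⟩ := hb
      rw [if_pos (by simp only [point]; omega), if_pos ⟨rfl, rfl⟩, neg_one_mul]
    · have := lam.block_end_le_or h0 hk' hb
      rw [if_neg (by simp only [point]; omega), if_neg hb, one_mul]

theorem blockSwap_point_left {m k r : ℕ} (hr : r < m) :
    blockSwap (lam.offset m + k * m) m (lam.point m k r) = lam.point m (k + 1) r := by
  rw [point, blockSwap_apply_left hr, point]
  push_cast
  ring

theorem blockSwap_point_right {m k r : ℕ} (hr : r < m) :
    blockSwap (lam.offset m + k * m) m (lam.point m (k + 1) r) = lam.point m k r := by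
  have hpt : lam.point m (k + 1) r = ((lam.offset m + k * m : ℕ) : ℤ) + m + r + 1 := by
    rw [point]
    push_cast
    ring
  rw [hpt, blockSwap_apply_right hr, point]

theorem isBlockPerm_blockSwap {m k : ℕ} (hk : k + 2 ≤ lam.mult m) :
    lam.IsBlockPerm (blockSwap (lam.offset m + k * m) m) := by
  have hk1 : k + 1 < lam.mult m := hk
  have hle := lam.block_end_le hk1
  have hn := lam.offset_le (m + 1)
  have hp := lam.le_offset m
  have hmul := Nat.succ_mul k m
  simp only [Nat.succ_eq_add_one] at hmul
  refine ⟨blockSwap_mem (by omega), fun x hx => ?_, fun m' k' hk' => ?_⟩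
  · exact blockSwap_apply_of_abs (Or.inl (by omega))
  · by_cases h1 : m = m' ∧ k = k'
    · obtain ⟨rfl, rfl⟩ := h1
      exact ⟨k + 1, hk1, 1, Or.inl rfl, fun r hr => by rw [blockSwap_point_left hr, one_mul]⟩
    by_cases h2 : m = m' ∧ k + 1 = k'
    · obtain ⟨rfl, rfl⟩ := h2
      exact ⟨k, by omega, 1, Or.inl rfl, fun r hr => by rw [blockSwap_point_right hr, one_mul]⟩
    refine ⟨k', hk', 1, Or.inl rfl, fun r hr => ?_⟩
    have h3 := lam.block_end_le_or (k := k) (by omega) hk' h1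
    have h4 := lam.block_end_le_or hk1 hk' h2
    rw [one_mul]
    apply blockSwap_apply_of_abs
    rw [abs_of_pos (lam.point_pos m' k' r), point]
    omega

theorem blockSign_mul_self (o m : ℕ) : blockSign o m * blockSign o m = 1 := by
  ext x
  rw [Equiv.Perm.mul_apply, blockSign_apply o m x, Equiv.Perm.one_apply]
  split_ifs with h
  · rw [blockSign_apply, abs_neg, if_pos h, neg_neg]
  · rw [blockSign_apply, if_neg h]

theorem blockSwap_mul_self (o m : ℕ) : blockSwap o m * blockSwap o m = 1 := by
  have hmem := blockSwap_mem (le_refl (o + 2 * m))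
  refine ext_of_nonneg (mul_mem hmem hmem) (one_mem _) fun x hx hxn => ?_
  rw [Equiv.Perm.mul_apply, Equiv.Perm.one_apply]
  rcases le_or_gt x o with h | h
  · have hfix : blockSwap o m x = x :=
      blockSwap_apply_of_abs (Or.inl (by rwa [abs_of_pos hx]))
    rw [hfix, hfix]
  rcases le_or_gt x (o + m) with h' | h'
  · obtain ⟨r, rfl⟩ : ∃ r : ℕ, x = o + r + 1 := ⟨(x - o - 1).toNat, by omega⟩
    rw [blockSwap_apply_left (by omega), blockSwap_apply_right (by omega)]
  · obtain ⟨r, rfl⟩ : ∃ r : ℕ, x = o + m + r + 1 := ⟨(x - o - m - 1).toNat, by omega⟩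
    rw [blockSwap_apply_right (by omega), blockSwap_apply_left (by omega)]

variable (lam) in
/-- The generators of `N_λ`. -/
def complementGens : Set (Equiv.Perm ℤ) :=
  {σ | ∃ m : ℕ, 1 ≤ m ∧ m ≤ n ∧ 0 < lam.mult m ∧
    (σ = blockSign (lam.offset m) m ∨
      ∃ k : ℕ, k + 2 ≤ lam.mult m ∧ σ = blockSwap (lam.offset m + k * m) m)}

theorem le_of_mult {m k : ℕ} (hk : k < lam.mult m) : m ≤ n := by
  have h1 := lam.block_end_le hk
  have h2 := lam.offset_le (m + 1)
  omega

theorem blockSign_mem_gens {m : ℕ} (h0 : 0 < lam.mult m) :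
    blockSign (lam.offset m) m ∈ lam.complementGens :=
  ⟨m, lam.pos_of_mult h0, le_of_mult h0, h0, Or.inl rfl⟩

theorem blockSwap_mem_gens {m k : ℕ} (hk : k + 2 ≤ lam.mult m) :
    blockSwap (lam.offset m + k * m) m ∈ lam.complementGens :=
  have h0 : 0 < lam.mult m := by omega
  ⟨m, lam.pos_of_mult h0, le_of_mult h0, h0, Or.inr ⟨k, hk, rfl⟩⟩

theorem isBlockPerm_of_mem_gens {s : Equiv.Perm ℤ} (hs : s ∈ lam.complementGens) :
    lam.IsBlockPerm s ∧ s * s = 1 := by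
  obtain ⟨m, -, -, h0, rfl | ⟨k, hk, rfl⟩⟩ := hs
  · exact ⟨isBlockPerm_blockSign h0, blockSign_mul_self _ _⟩
  · exact ⟨isBlockPerm_blockSwap hk, blockSwap_mul_self _ _⟩

/-- The generators are involutions, so closure under products is enough and inverses of general
block permutations are not needed. -/
theorem isBlockPerm_of_mem_complementN {s : Equiv.Perm ℤ} (hs : s ∈ lam.complementN) :
    lam.IsBlockPerm s := by
  change s ∈ Subgroup.closure lam.complementGens at hs
  rw [← Subgroup.mem_toSubmonoid, Subgroup.closure_toSubmonoid] at hs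
  induction hs using Submonoid.closure_induction with
  | mem x hx =>
    rcases hx with hx | hx
    · exact (isBlockPerm_of_mem_gens hx).1
    · have h := isBlockPerm_of_mem_gens (Set.mem_inv.1 hx)
      rw [← inv_eq_of_mul_eq_one_left h.2, inv_inv] at h
      exact h.1
  | one => exact isBlockPerm_one
  | mul x y _ _ hx hy => exact hx.mul hy

variable {v : Equiv.Perm ℤ}

/-- The sign of a centralizing element is constant on a positive cycle, so one negative value makes
the whole block negative. -/
theorem isDescent_blockSign (hv : v ∈ weylB n) (hc : Commute v lam.rep) {m : ℕ}
    (h0 : 0 < lam.mult m) (hneg : v (lam.point m 0 0) < 0) :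
    IsDescent n v (blockSign (lam.offset m) m) := by
  have hm := lam.pos_of_mult h0
  have hblock := isBlockPerm_blockSign h0
  refine ⟨hblock.1, blockSign_mul_self _ _, fun h1 => ?_, fun x hx => ?_⟩
  · have := blockSign_apply (lam.offset m) m (lam.point m 0 0)
    rw [h1, abs_of_pos (lam.point_pos m 0 0), if_pos (by simp only [point]; omega),
      Equiv.Perm.one_apply] at this
    have := lam.point_pos m 0 0
    omega
  · rw [blockSign_apply] at hx ⊢
    split_ifs at hx ⊢ with hif
    · obtain ⟨k', hk', r', hr', ε, hε, h⟩ := exists_apply_point hv hc h0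
      obtain ⟨r, hr, hxr⟩ : ∃ r : ℕ, r < m ∧ -x = lam.point m 0 r := by
        rw [abs_of_neg (by omega)] at hif
        exact ⟨(-x - lam.offset m - 1).toNat, by omega, by simp only [point]; omega⟩
      have hpos := lam.point_pos m k' ((r' + 0) % m)
      have hpos' := lam.point_pos m k' ((r' + r) % m)
      have h1 := h 0 hm
      have h2 := h r hr
      have h3 := weylB_neg hv x
      rw [hxr, h2] at h3 ⊢
      rcases hε with rfl | rfl <;> omega
    · omega

/-- The images of two cycles are told apart by their signs or, for equal signs, lie in disjoint
intervals; the order at one position therefore decides it at all positions, whatever the rotations.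
-/
theorem apply_point_lt (hv : v ∈ weylB n) (hc : Commute v lam.rep) {m k₁ k₂ r : ℕ}
    (hk₁ : k₁ < lam.mult m) (hk₂ : k₂ < lam.mult m) (hr : r < m)
    (hlt : v (lam.point m k₁ 0) < v (lam.point m k₂ 0)) :
    v (lam.point m k₁ r) < v (lam.point m k₂ r) := by
  have hm := lam.pos_of_mult hk₁
  obtain ⟨a₁, ha₁, r₁, hr₁, ε₁, hε₁, h₁⟩ := exists_apply_point hv hc hk₁
  obtain ⟨a₂, ha₂, r₂, hr₂, ε₂, hε₂, h₂⟩ := exists_apply_point hv hc hk₂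
  have e₁ := h₁ 0 hm
  have e₂ := h₂ 0 hm
  rw [add_zero, Nat.mod_eq_of_lt hr₁] at e₁
  rw [add_zero, Nat.mod_eq_of_lt hr₂] at e₂
  have hne : ε₁ = ε₂ → a₁ ≠ a₂ := by
    rintro rfl rfl
    have := eq_of_apply_point hc hε₁ hk₁ hk₂ ha₁ hr₁ hr₂ e₁ e₂
    subst this
    exact lt_irrefl _ hlt
  have hsep := lam.block_end_le_or ha₁ ha₂
  have b₁ := Nat.mod_lt (r₁ + r) hm
  have b₂ := Nat.mod_lt (r₂ + r) hm
  rw [e₁, e₂] at hlt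
  rw [h₁ r hr, h₂ r hr]
  simp only [point] at hlt ⊢
  rcases hε₁ with rfl | rfl <;> rcases hε₂ with rfl | rfl
  · have := hsep (fun h => hne rfl h.2); omega
  · omega
  · omega
  · have := hsep (fun h => hne rfl h.2); omega

theorem isDescent_blockSwap (hv : v ∈ weylB n) (hc : Commute v lam.rep) {m k : ℕ}
    (hk : k + 2 ≤ lam.mult m) (hlt : v (lam.point m (k + 1) 0) < v (lam.point m k 0)) :
    IsDescent n v (blockSwap (lam.offset m + k * m) m) := by
  have hk1 : k + 1 < lam.mult m := hk
  have hm := lam.pos_of_mult hk1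
  have hblock := isBlockPerm_blockSwap hk
  have hmul := Nat.succ_mul k m
  simp only [Nat.succ_eq_add_one] at hmul
  have hpt : ∀ r, r < m → lam.point m k r < lam.point m (k + 1) r := fun r hr => by
    simp only [point]; omega
  refine ⟨hblock.1, blockSwap_mul_self _ _, fun h1 => ?_, fun x hx => ?_⟩
  · have := blockSwap_point_left (lam := lam) (k := k) hm
    rw [h1, Equiv.Perm.one_apply] at this
    have := hpt 0 hm
    omega
  · have hx0 : ¬(|x| ≤ (lam.offset m + k * m : ℕ) ∨
        ((lam.offset m + k * m + 2 * m : ℕ) : ℤ) < |x|) := fun h => by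
      rw [blockSwap_apply_of_abs h] at hx
      omega
    obtain ⟨r, hr, hxr⟩ : ∃ r : ℕ, r < m ∧ (|x| = lam.point m k r ∨ |x| = lam.point m (k + 1) r) := by
      simp only [point]
      rcases le_or_gt |x| (lam.offset m + k * m + m : ℕ) with h | h
      · exact ⟨(|x| - (lam.offset m + k * m : ℕ) - 1).toNat, by omega, by omega⟩
      · exact ⟨(|x| - (lam.offset m + k * m : ℕ) - m - 1).toNat, by omega, by omega⟩
    have h1 := apply_point_lt hv hc hk1 (by omega) hr hlt
    have h2 := hpt r hr
    have h3 := blockSwap_point_left (lam := lam) (k := k) hr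
    have h4 := blockSwap_point_right (lam := lam) (k := k) hr
    -- Only points of the left block and negatives of points of the right block are moved upwards.
    rcases hxr with h | h <;> rcases eq_or_eq_neg_of_abs_eq h with rfl | rfl
    · rwa [h3]
    · rw [weylB_neg hblock.1, h3] at hx
      omega
    · rw [h4] at hx
      omega
    · rw [weylB_neg hblock.1, h4, weylB_neg hv, weylB_neg hv]
      omega

/-- The first cycle of each length has a positive image and the images increase, so all signs are
positive. The induced injection on the indices of the cycles is then strictly increasing and sends
each `j` to some `a ≥ j`, which gives the lower bound required for membership in `W_J`. -/
theorem mem_parabolic_of_no_descent (hv : v ∈ weylB n) (hc : Commute v lam.rep)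
    (hsign : ∀ m, 0 < lam.mult m → 0 ≤ v (lam.point m 0 0))
    (hswap : ∀ m k, k + 2 ≤ lam.mult m → v (lam.point m k 0) ≤ v (lam.point m (k + 1) 0)) :
    v ∈ parabolic (supportJ n lam.rep) := by
  refine lam.mem_parabolic_of_apply_point hv fun m k r hk hr => ?_
  have hm := lam.pos_of_mult hk
  have hpos : ∀ j, j < lam.mult m → 0 ≤ v (lam.point m j 0) := by
    intro j
    induction j with
    | zero => exact hsign m
    | succ j ih => exact fun hj => (ih (by omega)).trans (hswap m j hj)
  have hex : ∀ j, j < lam.mult m → ∃ a < lam.mult m, ∃ r' < m,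
      ∀ r < m, v (lam.point m j r) = lam.point m a ((r' + r) % m) := by
    intro j hj
    obtain ⟨a, ha, r', hr', ε, hε, h⟩ := exists_apply_point hv hc hj
    have h0 := h 0 hm
    have h1 := hpos j hj
    have h2 := lam.point_pos m a ((r' + 0) % m)
    rcases hε with rfl | rfl
    · exact ⟨a, ha, r', hr', fun r hr => by rw [h r hr, one_mul]⟩
    · omega
  have hle : ∀ j, j < lam.mult m → ∀ a r', a < lam.mult m → r' < m →
      v (lam.point m j 0) = lam.point m a r' → j ≤ a := by
    intro j
    induction j with
    | zero => intros; exact Nat.zero_le _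
    | succ j ih =>
      intro hj a r' ha hr' h
      obtain ⟨a₁, ha₁, r₁, hr₁, h₁⟩ := hex j (by omega)
      have e₁ := h₁ 0 hm
      rw [add_zero, Nat.mod_eq_of_lt hr₁] at e₁
      have := ih (by omega) a₁ r₁ ha₁ hr₁ e₁
      have hne : a₁ ≠ a := by
        rintro rfl
        have := eq_of_apply_point hc (Or.inl rfl) (k₁ := j) (k₂ := j + 1) (by omega) hj ha₁ hr₁ hr'
          (by rw [e₁, one_mul]) (by rw [h, one_mul])
        omega
      have hs := hswap m j hj
      rw [e₁, h] at hs
      by_contra! hlt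
      have := Nat.mul_le_mul_right m (show a + 1 ≤ a₁ by omega)
      rw [Nat.succ_mul] at this
      simp only [point] at hs
      omega
  obtain ⟨a, ha, r', hr', h⟩ := hex k hk
  have h0 := h 0 hm
  have := Nat.mul_le_mul_right m (hle k hk a _ ha (Nat.mod_lt _ hm) h0)
  rw [h r hr, point]
  omega

theorem exists_gen_descent (hv : v ∈ weylB n) (hc : Commute v lam.rep)
    (hp : v ∉ parabolic (supportJ n lam.rep)) : ∃ s ∈ lam.complementGens, IsDescent n v s := by
  by_contra! hno
  refine hp (mem_parabolic_of_no_descent hv hc (fun m h0 => ?_) fun m k hk => ?_)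
  · by_contra! h
    exact hno _ (blockSign_mem_gens h0) (isDescent_blockSign hv hc h0 h)
  · by_contra! h
    exact hno _ (blockSwap_mem_gens hk) (isDescent_blockSwap hv hc hk h)

end DoublePartition

/-! ### The complement -/

open SignedPerm in
theorem mem_centralizerIn_iff {G : Type*} [Group G] {H : Subgroup G} {v w : G} :
    v ∈ centralizerIn H w ↔ v ∈ H ∧ Commute v w := by
  rw [centralizerIn, Subgroup.mem_inf, Subgroup.mem_centralizer_singleton_iff]
  rfl

theorem mainTheorem9 (n : ℕ) (lam : DoublePartition n) :
    SignedPerm.IsComplementIn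
      (SignedPerm.centralizerIn
        (SignedPerm.parabolic (SignedPerm.supportJ n lam.rep)) lam.rep)
      lam.complementN
      (SignedPerm.centralizerIn (weylB n) lam.rep) := by
  have hK : SignedPerm.centralizerIn (SignedPerm.parabolic (SignedPerm.supportJ n lam.rep)) lam.rep
      ≤ SignedPerm.centralizerIn (weylB n) lam.rep := fun v hv => by
    rw [mem_centralizerIn_iff] at hv ⊢
    exact ⟨((SignedPerm.mem_parabolic_supportJ lam.rep_mem).1 hv.1).1, hv.2⟩
  have hN : lam.complementN ≤ SignedPerm.centralizerIn (weylB n) lam.rep := fun v hv => by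
    have h := DoublePartition.isBlockPerm_of_mem_complementN hv
    exact mem_centralizerIn_iff.2 ⟨h.1, h.commute⟩
  refine ⟨hK, hN, Subgroup.isComplement'_of_disjoint_and_mul_eq_univ ?_ ?_⟩
  · rw [Subgroup.disjoint_def]
    rintro ⟨v, hvC⟩ hvK hvN
    rw [Subgroup.mem_subgroupOf] at hvK hvN
    exact Subtype.ext ((DoublePartition.isBlockPerm_of_mem_complementN hvN).eq_one
      (mem_centralizerIn_iff.1 hvK).1)
  · refine Set.eq_univ_iff_forall.2 fun v => ?_
    -- Sorting gives `u` in `N_λ` with `v * u` in `W_J`; the factorization sought is `v = (v * u) *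
    -- u⁻¹`.
    obtain ⟨u, hu, hvu⟩ := SignedPerm.exists_mul_mem_of_descents (n := n)
      (C := SignedPerm.centralizerIn (weylB n) lam.rep)
      (fun x hx => (mem_centralizerIn_iff.1 hx).1) (T := lam.complementGens)
      (K := SignedPerm.parabolic (SignedPerm.supportJ n lam.rep))
      (fun s hs => hN (Subgroup.subset_closure hs))
      (fun x hx hxK => DoublePartition.exists_gen_descent (mem_centralizerIn_iff.1 hx).1
        (mem_centralizerIn_iff.1 hx).2 hxK) v v.2
    have huN : u ∈ lam.complementN := hu
    have huC := hN huN
    refine Set.mem_mul.2 ⟨v * ⟨u, huC⟩, ?_, (⟨u, huC⟩ : SignedPerm.centralizerIn (weylB n) lam.rep)⁻¹,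
      inv_mem (Subgroup.mem_subgroupOf.2 huN), mul_inv_cancel_right _ _⟩
    exact Subgroup.mem_subgroupOf.2 (mem_centralizerIn_iff.2
      ⟨hvu, (mem_centralizerIn_iff.1 (mul_mem v.2 huC)).2⟩)
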